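/- Let $\Omega$ be a finite alphabet with $|\Omega|=q\ge 2$, let $k\ge 3$, and let $P:\Omega^k\to\{0,1\}$ be a predicate that is not identically $1$. A probability distribution on $\Omega^k$ is $t$-wise uniform if its marginal on every set of $t$ coordinates is uniform; $P$ supports a $t$-wise uniform distribution if some $t$-wise uniform distribution is concentrated on $P^{-1}(1)$. Assume that $P$ supports a pairwise ($2$-wise) uniform distribution, and let $\mathcal C(P)$ be the minimum integer $3\le\tau\le k$ for which $P$ does not support a $\tau$-wise uniform distribution. Let $L$ be a nonempty set of permutations of $\Omega$, and let $P^{L}$ be the set of all predicates $x\mapsto P(\ell_1(x_1),\dots,\ell_k(x_k))$ with $\ell_1,\dots,\ell_k\in L$. (For $\Omega=\{0,1\}$ and $L$ consisting of the identity and the negation, $P^{L}=P^{\pm}$ is the family of the predicates obtained by letting $P$ act on literals.) A random instance of $\mathrm{CSP}(P^{L})$ with $n\ge k$ variables and $m$ constraints consists of $m$ independent constraints $(Q,S)$, with $Q\in P^{L}$ uniformly random and $S=(S_1,\dots,S_k)$ a uniformly random tuple of $k$ distinct variables in $[n]$. Use real indeterminates $x_{i,c}$ ($i\in[n]$, $c\in\Omega$).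 A degree-$d$ pseudoexpectation is a linear functional $\widetilde{\mathbf E}$ on real polynomials of degree at most $d$ with $\widetilde{\mathbf E}[1]=1$ and $\widetilde{\mathbf E}[p^2]\ge 0$ whenever $\deg p\le d/2$; it satisfies the identity $p=0$ if $\widetilde{\mathbf E}[pr]=0$ for every polynomial $r$ with $\deg p+\deg r\le d$. Degree-$d$ SOS fails to (weakly) refute an instance if there is a degree-$d$ pseudoexpectation that satisfies the identities $\sum_{c\in\Omega}x_{i,c}=1$ and $x_{i,c}^2=x_{i,c}$ for all $i,c$, and $$\sum_{c\in\Omega^k:\,Q(c)=1}\ \prod_{j=1}^k x_{S_j,c_j}=1$$ for every constraint $(Q,S)$ of the instance. Then there is a universal constant $C>0$ (independent of $q$, $\Omega$, $L$, $k$, $P$, $n$, $m$, $\Delta$, $\beta$) such that the following holds. Let $\Delta\ge 10$, let $m=\Delta n$ be an integer, and let $0<\beta<1$. Except with probability at most $\beta$ over a random instance $\mathcal I$ of $\mathrm{CSP}(P^{L})$ with $n$ variables and $m$ constraints, degree-$\lfloor D\rfloor$ SOS fails to refute $\mathcal I$, where $$D=\frac{\beta^{C/\mathcal C(P)}}{k\cdot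 2^{Ck/\mathcal C(P)}}\cdot\frac{n}{\Delta^{2/(\mathcal C(P)-2)}\,\log\Delta}.$$ -/

import Mathlib

namespace RandomCSP

/-! ### Predicates, `t`-wise uniformity, complexity -/

/-- A `k`-ary predicate over the alphabet `Ω`. -/
abbrev Predicate (Ω : Type*) (k : ℕ) : Type _ := (Fin k → Ω) → Bool

/-- `μ` is `t`-wise uniform: its marginal on every set `T` of `t` coordinates is uniform, i.e. every
local assignment on `T` (given as the restriction of some `y` to `T`) has probability `|Ω|⁻ᵗ`. -/
def IsWiseUniform {Ω : Type*} [Fintype Ω] [DecidableEq Ω] {k : ℕ} (t : ℕ)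
    (μ : (Fin k → Ω) → ℝ) : Prop :=
  ∀ T : Finset (Fin k), T.card = t → ∀ y : Fin k → Ω,
    ∑ x with ∀ i ∈ T, x i = y i, μ x = ((Fintype.card Ω : ℝ) ^ t)⁻¹

/-- `P` supports a `t`-wise uniform distribution: some `t`-wise uniform probability distribution
on `Ω ^ k` is concentrated on the satisfying assignments of `P`. -/
def SupportsUniform {Ω : Type*} [Fintype Ω] [DecidableEq Ω] {k : ℕ} (P : Predicate Ω k)
    (t : ℕ) : Prop :=
  ∃ μ ∈ stdSimplex ℝ (Fin k → Ω), IsWiseUniform t μ ∧ ∀ x, P x = false → μ x = 0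

/-- The complexity `C(P)`: the minimum integer `3 ≤ τ ≤ k` such that `P` does not support a
`τ`-wise uniform distribution.  It exists as soon as `3 ≤ k` and `P` is not identically true. -/
noncomputable def complexity {Ω : Type*} [Fintype Ω] [DecidableEq Ω] {k : ℕ}
    (P : Predicate Ω k) : ℕ :=
  sInf {τ | 3 ≤ τ ∧ τ ≤ k ∧ ¬ SupportsUniform P τ}

/-! ### Random CSPs -/

/-- The family of all predicates obtained by letting `P` act on literals, where a literal is a
variable to which one of the permutations of `Ω` in `L` is applied.  For `Ω = Bool` and
`L = Set.univ` (the identity and the negation) this is the family `P^±` of the `2 ^ k` predicates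
obtained from `P` by possibly negating its inputs. -/
def literalFamily {Ω : Type*} {k : ℕ} (P : Predicate Ω k) (L : Set (Equiv.Perm Ω)) :
    Set (Predicate Ω k) :=
  {Q | ∃ ℓ : Fin k → Equiv.Perm Ω, (∀ i, ℓ i ∈ L) ∧ Q = fun x => P (fun i => ℓ i (x i))}

/-- An instance of `CSP(F)` with `n` variables: a list of `m` constraints, each consisting of a
predicate from `F` and a scope of `k` distinct variables. -/
abbrev CSPInstance {Ω : Type*} {k : ℕ} (F : Set (Predicate Ω k)) (n m : ℕ) : Type _ :=
  Fin m → F × (Fin k ↪ Fin n)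

/-- The probability of the event `A` under the uniform distribution on the finite set `α`. -/
noncomputable def uniformProb {α : Type*} (A : Set α) : ℝ :=
  (A.ncard : ℝ) / (Nat.card α : ℝ)

/-! ### Sum of squares -/

open MvPolynomial in
/-- The polynomial in the indeterminates `X (i, c)` (standing for the indicator of "variable `i` is
assigned `c`") that indicates that the assignment to the scope `S` satisfies `Q`. -/
noncomputable def satPoly {Ω : Type*} [Fintype Ω] {k n : ℕ} (Q : Predicate Ω k)
    (S : Fin k ↪ Fin n) : MvPolynomial (Fin n × Ω) ℝ :=
  ∑ c with Q c = true, ∏ j, X (S j, c j)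

/-- `E` is a degree-`d` pseudoexpectation (with positive semidefiniteness).  A linear functional on
the polynomials of degree at most `d` is represented by any linear extension to all polynomials;
only values on polynomials of degree at most `d` matter. -/
structure IsPseudoexpectation {σ : Type*} (d : ℕ) (E : MvPolynomial σ ℝ →ₗ[ℝ] ℝ) : Prop where
  map_one : E 1 = 1
  sq_nonneg : ∀ p : MvPolynomial σ ℝ, 2 * p.totalDegree ≤ d → 0 ≤ E (p ^ 2)

/-- The degree-`d` pseudoexpectation `E` satisfies the polynomial identity `p = 0`. -/
def SatisfiesIdentity {σ : Type*} (d : ℕ) (E : MvPolynomial σ ℝ →ₗ[ℝ] ℝ)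
    (p : MvPolynomial σ ℝ) : Prop :=
  ∀ r : MvPolynomial σ ℝ, p.totalDegree + r.totalDegree ≤ d → E (p * r) = 0

open MvPolynomial in
/-- Degree-`d` SOS fails to (weakly) refute the instance `I`: there is a degree-`d`
pseudoexpectation satisfying the identities that say that the indeterminates encode an assignment
in `Ω ^ n`, and, for each constraint of `I`, the identity that the constraint is satisfied. -/
def SOSFailsToRefute {Ω : Type*} [Fintype Ω] {k n m : ℕ} {F : Set (Predicate Ω k)} (d : ℕ)
    (I : CSPInstance F n m) : Prop :=
  ∃ E : MvPolynomial (Fin n × Ω) ℝ →ₗ[ℝ] ℝ,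
    IsPseudoexpectation d E ∧
    (∀ i : Fin n, SatisfiesIdentity d E (∑ c : Ω, X (i, c) - 1)) ∧
    (∀ (i : Fin n) (c : Ω), SatisfiesIdentity d E (X (i, c) ^ 2 - X (i, c))) ∧
    ∀ f : Fin m, SatisfiesIdentity d E (satPoly (I f).1.1 (I f).2 - 1)

/-- The degree bound `β^(C/τ) / (k · 2^(C k/τ)) · n / (Δ^(2/(τ-2)) log Δ)`. -/
noncomputable def degreeBound (C β Δ : ℝ) (k τ n : ℕ) : ℝ :=
  β ^ (C / (τ : ℝ)) / ((k : ℝ) * (2 : ℝ) ^ (C * (k : ℝ) / (τ : ℝ))) *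
    ((n : ℝ) / (Δ ^ (2 / ((τ : ℝ) - 2)) * Real.log Δ))

end RandomCSP

open RandomCSP

/-! Each constraint $f$ gets the density of a $(\tau-1)$-wise uniform distribution supported on its
satisfying assignments, $\tau=\mathcal C(P)$. Such a factor integrates to one as soon as fewer than
$\tau$ of its coordinates are observed elsewhere, so factors can be peeled off until a tight set
remains.

For a set $A$ of variables, the closure of $A$ is a maximal set $U$ of at most $M$ factors with
$|N(U)\setminus A|\le(k-\tau/2)|U|$. The pseudoexpectation integrates a monomial on $A$ against the
factors of this closure. If $|N(U)|\ge(k-(\tau-\zeta)/2)|U|$ for all small $U$, closures have at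
most $2|A|/\zeta$ factors, so two of them can be merged within the budget $M$. Counting the
coordinates of a tight set (`IsTight.card_le`) against maximality shows that every further factor
can be peeled off; hence local integrals agree (`IsGood.sum_mul_weight`), and a constraint with
scope inside $A$ has its factor in the closure, which enforces its identity.

Positivity is a Gram-Schmidt argument. Take a variable set $S$ of maximal size and project its part
of the polynomial, under the local measure of $S$, onto the other admissible sets inside the region
$W$ of the closure. The residual is orthogonal even to monomials on sets $T$ not contained in $W$
(`pseudoExp_mul_eq_zero`): integrating out everything outside $W$ leaves a function of fewer than
$|S|$ variables, or of $T$ itself. The square therefore splits off a local square, and induction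
handles the rest.

Random instances expand by a first-moment bound over sets of $c\le M=\lfloor 8D/\zeta\rfloor$
constraints. With $\zeta=1/\log\Delta$ the loss in the exponent of $\Delta$ costs only
$\Delta^\zeta=e$, and the $c$-th term is at most $(\beta/2)^c$. -/

namespace RandomCSP

open Finset

/-! ### Averaging over coordinates -/

section Averaging

variable {ι Ω : Type*} [Fintype ι] [DecidableEq ι] [Fintype Ω]

/-- Exchanging the coordinates outside `W` of two points. -/
def swapOutside (W : Finset ι) : (ι → Ω) × (ι → Ω) ≃ (ι → Ω) × (ι → Ω) where
  toFun p := (W.piecewise p.1 p.2, W.piecewise p.2 p.1)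
  invFun p := (W.piecewise p.1 p.2, W.piecewise p.2 p.1)
  left_inv p := by
    ext i <;> by_cases h : i ∈ W <;> simp [h]
  right_inv p := by
    ext i <;> by_cases h : i ∈ W <;> simp [h]

/-- Fubini for the uniform measure: swapping the coordinates outside `W` between two independent
points preserves their joint law, and `a` does not see the swap. -/
theorem sum_mul_sum_piecewise (W : Finset ι) (a g : (ι → Ω) → ℝ) (ha : DependsOn a (W : Set ι)) :
    ∑ x, a x * ∑ y, g (W.piecewise x y) = (Fintype.card (ι → Ω) : ℝ) * ∑ x, a x * g x := by
  have h1 : ∑ x, a x * ∑ y, g (W.piecewise x y)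
      = ∑ p : (ι → Ω) × (ι → Ω), a (W.piecewise p.1 p.2) * g (W.piecewise p.1 p.2) := by
    rw [Fintype.sum_prod_type]
    refine sum_congr rfl fun x _ => ?_
    rw [mul_sum]
    refine sum_congr rfl fun y _ => ?_
    congr 1
    apply ha
    intro i hi
    have hi' : i ∈ W := hi
    simp [hi']
  rw [h1, ← (swapOutside W).symm.sum_comp]
  have h2 : ∀ p : (ι → Ω) × (ι → Ω),
      W.piecewise ((swapOutside W).symm p).1 ((swapOutside W).symm p).2 = p.1 := by
    intro p
    ext i
    by_cases h : i ∈ W <;> simp [h, swapOutside]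
  simp only [h2]
  rw [Fintype.sum_prod_type]
  simp [mul_sum]

/-- Exchanging the coordinates of `y` along an injection `S` with `z`. -/
noncomputable def swapAlong {κ : Type*} (S : κ ↪ ι) : (ι → Ω) × (κ → Ω) ≃ (ι → Ω) × (κ → Ω) where
  toFun p := (Function.extend S p.2 p.1, p.1 ∘ S)
  invFun p := (Function.extend S p.2 p.1, p.1 ∘ S)
  left_inv p := by
    refine Prod.ext ?_ ?_
    · ext i
      by_cases h : ∃ j, S j = i
      · obtain ⟨j, rfl⟩ := h
        simp [S.injective.extend_apply]
      · simp [Function.extend_apply' _ _ _ h]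
    · ext j
      simp [S.injective.extend_apply]
  right_inv p := by
    refine Prod.ext ?_ ?_
    · ext i
      by_cases h : ∃ j, S j = i
      · obtain ⟨j, rfl⟩ := h
        simp [S.injective.extend_apply]
      · simp [Function.extend_apply' _ _ _ h]
    · ext j
      simp [S.injective.extend_apply]

/-- A uniform point restricted along an injection is uniform. The form is cross-multiplied so that
it also makes sense when the spaces are empty. -/
theorem sum_comp_embedding {κ : Type*} [Fintype κ] [DecidableEq κ] (S : κ ↪ ι)
    (φ : (κ → Ω) → ℝ) :
    (Fintype.card (κ → Ω) : ℝ) * ∑ y : ι → Ω, φ (y ∘ S)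
      = (Fintype.card (ι → Ω) : ℝ) * ∑ z, φ z := by
  have h1 : (Fintype.card (κ → Ω) : ℝ) * ∑ y : ι → Ω, φ (y ∘ S)
      = ∑ p : (ι → Ω) × (κ → Ω), φ (p.1 ∘ S) := by
    rw [Fintype.sum_prod_type]
    simp [mul_sum]
  rw [h1]
  have h2 : ∀ p : (ι → Ω) × (κ → Ω), φ (p.1 ∘ S) = φ (swapAlong S p).2 := fun p => rfl
  simp only [h2]
  rw [(swapAlong S).sum_comp (fun p => φ p.2), Fintype.sum_prod_type]
  simp

theorem card_eq_off [DecidableEq Ω] (J : Finset ι) (w : ι → Ω) :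
    #{y : ι → Ω | ∀ i ∉ J, y i = w i} = Fintype.card Ω ^ #J := by
  have : ({y : ι → Ω | ∀ i ∉ J, y i = w i} : Finset (ι → Ω))
      = Fintype.piFinset (fun i => if i ∈ J then univ else {w i}) := by
    ext y
    simp only [mem_filter, mem_univ, true_and, Fintype.mem_piFinset]
    refine forall_congr' fun i => ?_
    by_cases h : i ∈ J <;> simp [h]
  rw [this, Fintype.card_piFinset]
  have h2 : ∀ i, #(if i ∈ J then (univ : Finset Ω) else {w i})
      = if i ∈ J then Fintype.card Ω else 1 := by
    intro i; split_ifs <;> simp [Finset.card_univ]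
  simp [h2]

/-- For each `w` agreeing with `x` on `J`, the `y` producing it are free exactly on `J`, which gives
the multiplicity. -/
theorem sum_piecewise_eq [DecidableEq Ω] (J : Finset ι) (x : ι → Ω) (μ : (ι → Ω) → ℝ) :
    ∑ y, μ (J.piecewise x y)
      = (Fintype.card Ω : ℝ) ^ #J * ∑ w with ∀ i ∈ J, w i = x i, μ w := by
  have h1 : ∑ y, μ (J.piecewise x y)
      = ∑ w with ∀ i ∈ J, w i = x i, ∑ y with J.piecewise x y = w, μ (J.piecewise x y) := by
    symm
    apply sum_fiberwise_of_maps_to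
    intro y _
    simp only [mem_filter, mem_univ, true_and]
    intro i hi
    simp [hi]
  rw [h1, mul_sum]
  refine sum_congr rfl fun w hw => ?_
  have hw' : ∀ i ∈ J, w i = x i := by simpa using hw
  have h3 : ∑ y with J.piecewise x y = w, μ (J.piecewise x y)
      = ∑ y with J.piecewise x y = w, μ w :=
    sum_congr rfl fun y hy => by rw [(mem_filter.1 hy).2]
  rw [h3, sum_const, nsmul_eq_mul]
  congr 1
  have h4 : (univ.filter fun y : ι → Ω => J.piecewise x y = w)
      = univ.filter fun y : ι → Ω => ∀ i ∉ J, y i = w i := by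
    ext y
    simp only [mem_filter, mem_univ, true_and]
    constructor
    · rintro rfl i hi
      simp [hi]
    · intro h
      ext i
      by_cases hi : i ∈ J
      · simp [hi, hw' i hi]
      · simp [hi, h i hi]
  rw [h4, card_eq_off]
  push_cast
  rfl

end Averaging

/-- The density of a `t`-wise uniform distribution integrates to one over all coordinates of its
scope, once at most `t` of them are retained. -/
theorem IsWiseUniform.sum_mul_density {ι Ω : Type*} [Fintype ι] [DecidableEq ι] [Fintype Ω]
    [DecidableEq Ω] {k t : ℕ} {μ : (Fin k → Ω) → ℝ} (hμ : IsWiseUniform t μ)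
    (htk : t ≤ k) (S : Fin k ↪ ι) (R : Finset ι) (hR : #(univ.map S ∩ R) ≤ t)
    (g : (ι → Ω) → ℝ) (hg : DependsOn g (R : Set ι)) :
    ∑ x, g x * ((Fintype.card Ω : ℝ) ^ k * μ (x ∘ S)) = ∑ x, g x := by
  rcases isEmpty_or_nonempty (ι → Ω) with he | hne
  · simp
  have hJ0 : #{j | S j ∈ R} ≤ t := by
    refine le_trans (le_of_eq ?_) hR
    rw [← card_map S]
    congr 1
    ext i
    simp only [mem_map, mem_filter, mem_univ, true_and, mem_inter]
    constructor
    · rintro ⟨j, hj, rfl⟩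
      exact ⟨⟨j, rfl⟩, hj⟩
    · rintro ⟨⟨j, rfl⟩, hj⟩
      exact ⟨j, hj, rfl⟩
  -- Uniformity is only assumed on exactly `t` coordinates, so the retained ones are padded to `t`.
  obtain ⟨J, hJ1, hJ2⟩ := exists_superset_card_eq hJ0 (by simpa using htk)
  -- Only the scope coordinates outside `J` are integrated out; `g` depends on none of them.
  set A : Finset ι := (univ.map S \ J.map S)ᶜ with hA
  have hRA : (R : Set ι) ⊆ (A : Set ι) := by
    intro i hi
    have hi' : i ∈ R := hi
    simp only [hA, coe_compl, coe_sdiff, Set.mem_compl_iff, Set.mem_sdiff, not_and, not_not]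
    intro h
    obtain ⟨j, -, rfl⟩ := mem_map.1 (mem_coe.1 h)
    exact mem_coe.2 (mem_map_of_mem _ (hJ1 (by simpa using hi')))
  have hSA : ∀ j, S j ∈ A ↔ j ∈ J := by
    intro j
    simp [hA]
  have hgA : DependsOn g (A : Set ι) := hg.mono hRA
  have hcard : (Fintype.card (ι → Ω) : ℝ) ≠ 0 := by
    exact_mod_cast Fintype.card_ne_zero
  have hΩk : Nonempty (Fin k → Ω) := ⟨hne.some ∘ S⟩
  have hcardk : (Fintype.card (Fin k → Ω) : ℝ) ≠ 0 := by
    exact_mod_cast Fintype.card_ne_zero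
  have hck : (Fintype.card (Fin k → Ω) : ℝ) = (Fintype.card Ω : ℝ) ^ k := by simp
  have key : ∀ x : ι → Ω,
      ∑ y, ((Fintype.card Ω : ℝ) ^ k * μ (A.piecewise x y ∘ S)) = Fintype.card (ι → Ω) := by
    intro x
    have h1 : ∀ y, A.piecewise x y ∘ S = J.piecewise (x ∘ S) (y ∘ S) := by
      intro y
      ext j
      by_cases h : j ∈ J
      · simp [h, (hSA j).2 h]
      · have : S j ∉ A := fun h' => h ((hSA j).1 h')
        simp [h, this]
    simp only [h1]
    have hq : (Fintype.card Ω : ℝ) ^ t ≠ 0 := by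
      rcases Nat.eq_zero_or_pos t with rfl | ht
      · simp
      · have : Nonempty Ω := ⟨hΩk.some ⟨0, by omega⟩⟩
        positivity
    have h5 : ∑ z, μ (J.piecewise (x ∘ S) z) = 1 := by
      rw [sum_piecewise_eq, hJ2, ← mul_inv_cancel₀ hq, ← hμ J hJ2 (x ∘ S)]
      congr!
    rw [← mul_sum, ← hck, sum_comp_embedding S (fun z => μ (J.piecewise (x ∘ S) z)), h5, mul_one]
  have h2 := sum_mul_sum_piecewise A g (fun x => (Fintype.card Ω : ℝ) ^ k * μ (x ∘ S)) hgA
  simp only [key] at h2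
  rw [← sum_mul, mul_comm] at h2
  exact (mul_left_cancel₀ hcard h2).symm

end RandomCSP

namespace RandomCSP

open Finset

/-! ### Factor systems -/

/-- A family of nonnegative factors on `Ω ^ ι`, indexed by `κ`, each depending on a scope of `k`
coordinates and integrating to one as soon as fewer than `τ` coordinates of its scope are
retained. -/
structure FactorSystem (ι Ω κ : Type*) [Fintype ι] [DecidableEq ι] [Fintype Ω] (k τ : ℕ) where
  scope : κ → Finset ι
  density : κ → (ι → Ω) → ℝ
  card_scope : ∀ f, #(scope f) = k
  density_nonneg : ∀ f x, 0 ≤ density f x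
  dependsOn_density : ∀ f, DependsOn (density f) (scope f : Set ι)
  sum_mul_density : ∀ (f) (R : Finset ι), #(scope f ∩ R) < τ →
    ∀ g : (ι → Ω) → ℝ, DependsOn g (R : Set ι) → ∑ x, g x * density f x = ∑ x, g x

theorem dependsOn_mul {ι Ω : Type*} {a b : (ι → Ω) → ℝ} {s : Set ι} (ha : DependsOn a s)
    (hb : DependsOn b s) : DependsOn (fun x => a x * b x) s := by
  intro x y h
  simp only [ha h, hb h]

namespace FactorSystem

variable {ι Ω κ : Type*} [Fintype ι] [DecidableEq ι] [Fintype Ω] {k τ : ℕ}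
  (G : FactorSystem ι Ω κ k τ)

/-- The coordinates occurring in the factors of `U`. -/
def nbhd (U : Finset κ) : Finset ι := U.biUnion G.scope

/-- The product of the factors of `U`. -/
def weight (U : Finset κ) (x : ι → Ω) : ℝ := ∏ f ∈ U, G.density f x

theorem weight_nonneg (U : Finset κ) (x : ι → Ω) : 0 ≤ G.weight U x :=
  prod_nonneg fun f _ => G.density_nonneg f x

theorem nbhd_mono {U U' : Finset κ} (h : U ⊆ U') : G.nbhd U ⊆ G.nbhd U' :=
  biUnion_subset_biUnion_of_subset_left _ h

theorem scope_subset_nbhd {U : Finset κ} {f : κ} (h : f ∈ U) : G.scope f ⊆ G.nbhd U :=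
  subset_biUnion_of_mem _ h

theorem dependsOn_weight (U : Finset κ) : DependsOn (G.weight U) (G.nbhd U : Set ι) := by
  intro x y h
  refine prod_congr rfl fun f hf => G.dependsOn_density f ?_
  intro i hi
  exact h i (G.scope_subset_nbhd hf hi)

/-- Every factor of `K` has at least `τ` coordinates that lie in `R` or in another factor. -/
def IsTight [DecidableEq κ] (R : Finset ι) (K : Finset κ) : Prop :=
  ∀ f ∈ K, τ ≤ #(G.scope f ∩ (R ∪ G.nbhd (K.erase f)))

/-- Factors can be integrated out one by one until a tight set is left. -/
theorem exists_isTight [DecidableEq κ] (R : Finset ι) (K : Finset κ) :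
    ∃ K' ⊆ K, G.IsTight R K' ∧ ∀ g : (ι → Ω) → ℝ, DependsOn g (R : Set ι) →
      ∑ x, g x * G.weight K x = ∑ x, g x * G.weight K' x := by
  induction K using Finset.strongInduction with
  | H K ih =>
    by_cases hK : G.IsTight R K
    · exact ⟨K, Subset.rfl, hK, fun _ _ => rfl⟩
    · unfold IsTight at hK
      push Not at hK
      obtain ⟨f, hf, hlt⟩ := hK
      obtain ⟨K', hK', ht, h⟩ := ih (K.erase f) (erase_ssubset hf)
      refine ⟨K', hK'.trans (erase_subset _ _), ht, fun g hg => ?_⟩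
      -- The remaining integrand meets `f` in fewer than `τ` coordinates, so `f` integrates to one.
      rw [← h g hg, ← G.sum_mul_density f _ hlt (fun x => g x * G.weight (K.erase f) x)]
      · refine sum_congr rfl fun x _ => ?_
        unfold weight
        rw [← prod_erase_mul K _ hf, mul_assoc]
      · refine dependsOn_mul (hg.mono ?_) ((G.dependsOn_weight _).mono ?_)
        · exact_mod_cast subset_union_left
        · exact_mod_cast subset_union_right

/-- Double counting of incidences: degrees over `K` sum to `k * #K`, and tightness makes coordinates
that lie in `W ∪ T` or have degree at least two carry at least `τ * #K` of them. -/
theorem IsTight.card_le [DecidableEq κ] {G : FactorSystem ι Ω κ k τ} {W T : Finset ι}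
    {K : Finset κ}
    (hK : G.IsTight (W ∪ T) K) :
    2 * #(G.nbhd K \ W) + #(W ∩ G.nbhd K) + τ * #K ≤ 2 * k * #K + #(T \ W) := by
  classical
  set X := G.nbhd K with hX
  let deg : ι → ℕ := fun v => #{f ∈ K | v ∈ G.scope f}
  let shared : ι → Prop := fun v => v ∈ W ∪ T ∨ 2 ≤ deg v
  have hdeg : ∀ v ∈ X, 1 ≤ deg v := by
    intro v hv
    obtain ⟨f, hf, hvf⟩ := mem_biUnion.1 hv
    exact card_pos.2 ⟨f, mem_filter.2 ⟨hf, hvf⟩⟩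
  have hcount : ∀ (p : ι → Prop) [DecidablePred p],
      ∑ v ∈ X with p v, deg v = ∑ f ∈ K, #{v ∈ G.scope f | p v} := by
    intro p _
    have : ∀ f ∈ K, #{v ∈ G.scope f | p v} = #{v ∈ X.filter p | v ∈ G.scope f} := by
      intro f hf
      congr 1
      ext v
      simp only [mem_filter]
      constructor
      · rintro ⟨h1, h2⟩
        exact ⟨⟨G.scope_subset_nbhd hf h1, h2⟩, h1⟩
      · rintro ⟨⟨_, h2⟩, h1⟩
        exact ⟨h1, h2⟩
    rw [sum_congr rfl this]
    exact sum_card_bipartiteAbove_eq_sum_card_bipartiteBelow (fun v f => v ∈ G.scope f)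
  have htot : ∑ v ∈ X, deg v = k * #K := by
    have := hcount (fun _ => True)
    simp only [filter_true] at this
    rw [this, sum_congr rfl (fun f _ => G.card_scope f)]
    simp [mul_comm]
  have hsh : τ * #K ≤ ∑ v ∈ X with shared v, deg v := by
    rw [hcount, mul_comm, ← smul_eq_mul]
    apply card_nsmul_le_sum
    intro f hf
    refine (hK f hf).trans (card_le_card ?_)
    intro v hv
    obtain ⟨h1, h2⟩ := mem_inter.1 hv
    refine mem_filter.2 ⟨h1, ?_⟩
    rcases mem_union.1 h2 with h2 | h2
    · exact Or.inl h2
    · obtain ⟨f', hf', hv'⟩ := mem_biUnion.1 h2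
      right
      have : ({f, f'} : Finset κ) ⊆ {f ∈ K | v ∈ G.scope f} := by
        intro e he
        rcases mem_insert.1 he with rfl | he
        · exact mem_filter.2 ⟨hf, h1⟩
        · rw [mem_singleton.1 he]
          exact mem_filter.2 ⟨mem_of_mem_erase hf', hv'⟩
      calc 2 = #({f, f'} : Finset κ) := (card_pair (ne_of_mem_erase hf').symm).symm
        _ ≤ _ := card_le_card this
  -- The inequality is local to each coordinate. The only deficit is at a coordinate of degree one
  -- in `T \ W`, paid for by the last term.
  have hpt : ∀ v ∈ X, (2 * (if v ∉ W then 1 else 0) + (if v ∈ W then 1 else 0))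
      + (if shared v then deg v else 0) ≤ 2 * deg v + (if v ∈ T \ W then 1 else 0) := by
    intro v hv
    have h1 := hdeg v hv
    by_cases hW : v ∈ W
    · have : shared v := Or.inl (mem_union_left _ hW)
      simp [hW, this]; omega
    · by_cases hT : v ∈ T
      · have : shared v := Or.inl (mem_union_right _ hT)
        simp [hW, hT, this]; omega
      · by_cases h2 : 2 ≤ deg v
        · have : shared v := Or.inr h2
          simp [hW, hT, this]; omega
        · have : ¬ shared v := by simp [shared, hW, hT]; omega
          simp [hW, hT, this]; omega
  have hsum := sum_le_sum hpt
  simp only [sum_add_distrib, ← mul_sum, ← sum_filter, htot, sum_const,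
    smul_eq_mul, mul_one] at hsum
  have e1 : #{v ∈ X | v ∉ W} = #(X \ W) := by congr 1; ext v; simp
  have e2 : #{v ∈ X | v ∈ W} = #(W ∩ X) := by congr 1; ext v; simp [and_comm]
  have e3 : #{v ∈ X | v ∈ T \ W} ≤ #(T \ W) := card_le_card (by intro v; simp)
  simp only [e1, e2] at hsum
  rw [sum_filter] at hsh
  rw [mul_assoc]
  omega

/-! ### Cheap sets of factors -/

/-- The set `U` of factors brings in few coordinates outside `A`. -/
def IsCheap (A : Finset ι) (U : Finset κ) : Prop :=
  2 * #(G.nbhd U \ A) + τ * #U ≤ 2 * k * #U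

/-- `U` is maximal among the cheap sets of at most `M` factors. -/
structure IsGood (M : ℕ) (A : Finset ι) (U : Finset κ) : Prop where
  card_le : #U ≤ M
  cheap : G.IsCheap A U
  maximal : ∀ U', U ⊂ U' → #U' ≤ M → ¬ G.IsCheap A U'

theorem exists_isGood [Fintype κ] {M : ℕ} {A : Finset ι} {U : Finset κ} (hU : G.IsCheap A U)
    (hM : #U ≤ M) : ∃ U', U ⊆ U' ∧ G.IsGood M A U' := by
  obtain ⟨U', h1, h2⟩ := Finite.exists_le_maximal (p := fun U => #U ≤ M ∧ G.IsCheap A U) ⟨hM, hU⟩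
  refine ⟨U', h1, h2.prop.1, h2.prop.2, fun V hV hVM hc => ?_⟩
  exact hV.2 (h2.le_of_ge ⟨hVM, hc⟩ hV.1)

theorem isCheap_empty (A : Finset ι) : G.IsCheap A ∅ := by
  simp [IsCheap, nbhd]

variable {G}

theorem IsCheap.mono {A B : Finset ι} {U : Finset κ} (h : G.IsCheap A U) (hAB : A ⊆ B) :
    G.IsCheap B U := by
  have : #(G.nbhd U \ B) ≤ #(G.nbhd U \ A) := card_le_card (sdiff_subset_sdiff Subset.rfl hAB)
  unfold IsCheap at *
  omega

/-- Subtracting cheapness of `U` from the failure of cheapness of `U ∪ K` bounds `G.nbhd K` outside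
the good region from below; the count for tight sets bounds it from above. What is left compares the
overlap of `K` with the region to the part of `T` outside it. -/
theorem IsGood.card_inter_lt [DecidableEq κ] {M : ℕ} {A T : Finset ι} {U K : Finset κ}
    (hU : G.IsGood M A U) (hdisj : Disjoint U K) (hne : K.Nonempty) (hM : #(U ∪ K) ≤ M)
    (hK : G.IsTight ((G.nbhd U ∪ A) ∪ T) K) :
    #((G.nbhd U ∪ A) ∩ G.nbhd K) < #(T \ (G.nbhd U ∪ A)) := by
  have h1 := hK.card_le
  have hss : U ⊂ U ∪ K := by
    refine ⟨subset_union_left, fun h => ?_⟩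
    obtain ⟨f, hf⟩ := hne
    exact disjoint_left.1 hdisj (h (mem_union_right _ hf)) hf
  have h2 := hU.maximal _ hss hM
  have h3 := hU.cheap
  unfold IsCheap at h2 h3
  rw [card_union_of_disjoint hdisj] at h2
  have h4 : #(G.nbhd (U ∪ K) \ A) ≤ #(G.nbhd U \ A) + #(G.nbhd K \ (G.nbhd U ∪ A)) := by
    refine le_trans (card_le_card ?_) (card_union_le _ _)
    intro v
    simp only [nbhd, union_biUnion, mem_sdiff, mem_union]
    tauto
  have e1 := mul_add τ #U #K
  have e2 := mul_add (2 * k) #U #K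
  omega

/-- Adding further factors does not change integrals of functions of the coordinates of a good
set. -/
theorem IsGood.sum_mul_weight [DecidableEq κ] {M : ℕ} {A : Finset ι} {U U' : Finset κ}
    (hU : G.IsGood M A U) (hUU' : U ⊆ U') (hM : #U' ≤ M) (g : (ι → Ω) → ℝ)
    (hg : DependsOn g ((G.nbhd U ∪ A : Finset ι) : Set ι)) :
    ∑ x, g x * G.weight U' x = ∑ x, g x * G.weight U x := by
  obtain ⟨K, hK, ht, h⟩ := G.exists_isTight (G.nbhd U ∪ A) (U' \ U)
  have h1 : ∀ x, g x * G.weight U' x = (g x * G.weight U x) * G.weight (U' \ U) x := by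
    intro x
    unfold weight
    rw [← prod_sdiff hUU']
    ring
  simp only [h1]
  rw [h]
  · rcases K.eq_empty_or_nonempty with rfl | hne
    · simp [weight]
    · exfalso
      -- With `T` empty a nonempty tight `K` would have overlap less than zero, so every added
      -- factor is peeled off.
      have := hU.card_inter_lt (T := ∅) (K := K) ?_ hne ?_ (by simpa using ht)
      · simp at this
      · exact disjoint_of_subset_right hK disjoint_sdiff
      · refine le_trans (card_le_card (union_subset hUU' (hK.trans sdiff_subset))) hM
  · exact dependsOn_mul hg ((G.dependsOn_weight U).mono (by exact_mod_cast subset_union_left))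

variable (G) in
/-- Every small set of factors has many coordinates. -/
def IsExpanding (M : ℕ) (ζ : ℝ) : Prop :=
  ∀ U : Finset κ, #U ≤ M → (2 * k + ζ) * #U ≤ 2 * #(G.nbhd U) + τ * #U

/-- Expansion and cheapness differ by `ζ * #U`, and only the coordinates in `A` can make up for it.
-/
theorem IsCheap.card_le {M : ℕ} {ζ : ℝ} (hG : G.IsExpanding M ζ) {A : Finset ι} {U : Finset κ}
    (hU : G.IsCheap A U) (hM : #U ≤ M) : ζ * #U ≤ 2 * #A := by
  have h1 := hG U hM
  have h2 : (2 * #(G.nbhd U \ A) + τ * #U : ℝ) ≤ 2 * k * #U := by exact_mod_cast hU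
  have h3 : (#(G.nbhd U) : ℝ) ≤ #(G.nbhd U \ A) + #A := by
    have : #(G.nbhd U) ≤ #(G.nbhd U \ A) + #A := by
      refine le_trans (card_le_card ?_) (card_union_le _ _)
      intro v; simp; tauto
    exact_mod_cast this
  nlinarith

end FactorSystem

end RandomCSP

namespace RandomCSP

open Finset MvPolynomial

/-! ### Polynomials as functions on `Ω ^ ι` -/

section Polynomials

set_option linter.unusedSectionVars false

variable {ι Ω : Type*} [DecidableEq ι] [DecidableEq Ω]

/-- Evaluation at the point of the hypercube that encodes the assignment `x`. -/
noncomputable def evalPoint (x : ι → Ω) : MvPolynomial (ι × Ω) ℝ →ₐ[ℝ] ℝ :=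
  aeval fun p => if x p.1 = p.2 then 1 else 0

/-- The variables whose indeterminates occur in a monomial. -/
def varSet (s : (ι × Ω) →₀ ℕ) : Finset ι := s.support.image Prod.fst

/-- The span of the monomials whose set of variables belongs to `C`. -/
noncomputable def polyIn (C : Set (Finset ι)) : Submodule ℝ (MvPolynomial (ι × Ω) ℝ) :=
  Submodule.span ℝ ((fun s => monomial s (1 : ℝ)) '' {s | varSet s ∈ C})

theorem monomial_mem_polyIn {C : Set (Finset ι)} {s : (ι × Ω) →₀ ℕ} (hs : varSet s ∈ C) (a : ℝ) :
    monomial s a ∈ polyIn C := by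
  have : monomial s a = a • monomial s (1 : ℝ) := by simp [smul_monomial]
  rw [this]
  exact Submodule.smul_mem _ _ (Submodule.subset_span ⟨s, hs, rfl⟩)

theorem mem_polyIn {C : Set (Finset ι)} {p : MvPolynomial (ι × Ω) ℝ}
    (h : ∀ s ∈ p.support, varSet s ∈ C) : p ∈ polyIn C := by
  rw [p.as_sum]
  exact Submodule.sum_mem _ fun s hs => monomial_mem_polyIn (h s hs) _

theorem polyIn_mono {C C' : Set (Finset ι)} (h : C ⊆ C') :
    (polyIn C : Submodule ℝ (MvPolynomial (ι × Ω) ℝ)) ≤ polyIn C' :=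
  Submodule.span_mono (Set.image_mono fun _ hs => h hs)

theorem polyIn_union (C C' : Set (Finset ι)) :
    (polyIn (C ∪ C') : Submodule ℝ (MvPolynomial (ι × Ω) ℝ)) = polyIn C ⊔ polyIn C' := by
  unfold polyIn
  rw [← Submodule.span_union, ← Set.image_union]
  rfl

theorem varSet_add (s s' : (ι × Ω) →₀ ℕ) : varSet (s + s') = varSet s ∪ varSet s' := by
  classical
  unfold varSet
  rw [← image_union]
  congr 1
  ext i
  simp [Finsupp.mem_support_iff]
  tauto

theorem mul_mem_polyIn {C C' C'' : Set (Finset ι)} (h : ∀ a ∈ C, ∀ b ∈ C', a ∪ b ∈ C'')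
    {p q : MvPolynomial (ι × Ω) ℝ} (hp : p ∈ polyIn C) (hq : q ∈ polyIn C') :
    p * q ∈ polyIn C'' := by
  have h1 := Submodule.mul_mem_mul hp hq
  unfold polyIn at h1
  rw [Submodule.span_mul_span] at h1
  refine Submodule.span_le.2 ?_ h1
  rintro _ ⟨_, ⟨s, hs, rfl⟩, _, ⟨s', hs', rfl⟩, rfl⟩
  simp only [monomial_mul, one_mul]
  exact monomial_mem_polyIn (by rw [varSet_add]; exact h _ hs _ hs') _

theorem card_varSet_le (s : (ι × Ω) →₀ ℕ) : #(varSet s) ≤ s.sum fun _ e => e := by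
  refine card_image_le.trans ?_
  rw [Finsupp.sum, card_eq_sum_ones]
  exact sum_le_sum fun i hi => Nat.one_le_iff_ne_zero.2 (Finsupp.mem_support_iff.1 hi)

theorem mem_polyIn_of_totalDegree_le {d : ℕ} {p : MvPolynomial (ι × Ω) ℝ}
    (h : p.totalDegree ≤ d) : p ∈ polyIn {T | #T ≤ d} :=
  mem_polyIn fun s hs => (card_varSet_le s).trans ((le_totalDegree hs).trans h)

theorem evalPoint_X (x : ι → Ω) (p : ι × Ω) :
    evalPoint x (X p) = if x p.1 = p.2 then 1 else 0 := by
  simp [evalPoint]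

theorem dependsOn_monomial (s : (ι × Ω) →₀ ℕ) :
    DependsOn (fun x => evalPoint x (monomial s 1)) (varSet s : Set ι) := by
  intro x y h
  simp only [evalPoint, aeval_monomial]
  congr 1
  refine Finsupp.prod_congr fun p hp => ?_
  have : x p.1 = y p.1 := h _ (mem_coe.2 (mem_image_of_mem _ hp))
  rw [this]

theorem dependsOn_of_mem_polyIn {C : Set (Finset ι)} {W : Finset ι} (hC : ∀ T ∈ C, T ⊆ W)
    {p : MvPolynomial (ι × Ω) ℝ} (hp : p ∈ polyIn C) :
    DependsOn (fun x => evalPoint x p) (W : Set ι) := by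
  intro x y h
  induction hp using Submodule.span_induction with
  | mem p hp =>
    obtain ⟨s, hs, rfl⟩ := hp
    exact dependsOn_monomial s fun i hi => h i (hC _ hs hi)
  | zero => simp
  | add p q _ _ hp hq => simp only [map_add, hp, hq]
  | smul a p _ hp => simp only [map_smul, hp]

theorem one_mem_polyIn {C : Set (Finset ι)} (h : ∅ ∈ C) :
    (1 : MvPolynomial (ι × Ω) ℝ) ∈ polyIn C := by
  have : varSet (0 : (ι × Ω) →₀ ℕ) ∈ C := by simpa [varSet] using h
  exact monomial_mem_polyIn this 1

theorem X_mem_polyIn {C : Set (Finset ι)} {i : ι} (h : {i} ∈ C) (c : Ω) :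
    (X (i, c) : MvPolynomial (ι × Ω) ℝ) ∈ polyIn C := by
  have : varSet (Finsupp.single (i, c) 1) ∈ C := by
    simpa [varSet, Finsupp.support_single] using h
  exact monomial_mem_polyIn this 1

theorem prod_X_mem_polyIn (B : Finset ι) (y : ι → Ω) :
    (∏ i ∈ B, X (i, y i) : MvPolynomial (ι × Ω) ℝ) ∈ polyIn {T | T ⊆ B} := by
  induction B using Finset.induction_on with
  | empty =>
    rw [prod_empty]
    exact one_mem_polyIn (Subset.refl ∅)
  | insert i B hi ih =>
    rw [prod_insert hi]
    have hX : (X (i, y i) : MvPolynomial (ι × Ω) ℝ) ∈ polyIn ({ {i} } : Set (Finset ι)) :=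
      X_mem_polyIn (Set.mem_singleton _) (y i)
    refine mul_mem_polyIn ?_ hX ih
    rintro a rfl b hb
    exact union_subset (by simp) (Subset.trans hb (subset_insert _ _))

/-- Interpolation by indicators of assignments on `B`. Summing over full assignments counts each one
once per extension, whence the divisor. -/
theorem exists_poly_of_dependsOn [Fintype ι] [Fintype Ω] {B : Finset ι} {b : (ι → Ω) → ℝ}
    (hb : DependsOn b (B : Set ι)) : ∃ p ∈ polyIn {T | T ⊆ B}, ∀ x, evalPoint x p = b x := by
  refine ⟨∑ y : ι → Ω, (b y / (Fintype.card Ω : ℝ) ^ #Bᶜ) • ∏ i ∈ B, X (i, y i),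
    Submodule.sum_mem _ fun y _ => Submodule.smul_mem _ _ (prod_X_mem_polyIn B y), fun x => ?_⟩
  have hprod : ∀ y : ι → Ω, (∏ i ∈ B, if x i = y i then (1 : ℝ) else 0)
      = if ∀ i ∉ Bᶜ, y i = x i then 1 else 0 := by
    intro y
    rw [prod_ite_zero]
    simp [eq_comm]
  simp only [map_sum, map_smul, map_prod, evalPoint_X, smul_eq_mul, hprod, mul_ite, mul_one,
    mul_zero]
  rw [← sum_filter]
  have h1 : ∑ y : ι → Ω with ∀ i ∉ Bᶜ, y i = x i, b y / (Fintype.card Ω : ℝ) ^ #Bᶜ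
      = ∑ y : ι → Ω with ∀ i ∉ Bᶜ, y i = x i, b x / (Fintype.card Ω : ℝ) ^ #Bᶜ := by
    refine sum_congr rfl fun y hy => ?_
    congr 1
    refine hb fun i hi => (mem_filter.1 hy).2 i ?_
    simpa using hi
  rw [h1, sum_const, card_eq_off, nsmul_eq_mul]
  have hq : (Fintype.card Ω : ℝ) ^ #Bᶜ ≠ 0 := by
    rcases (Bᶜ).eq_empty_or_nonempty with h | ⟨i, hi⟩
    · simp [h]
    · have : Nonempty Ω := ⟨x i⟩
      positivity
  push_cast
  field_simp

/-- Orthogonal projection with respect to a nonnegative weight. -/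
theorem exists_weighted_projection [Fintype ι] [Fintype Ω] (w : (ι → Ω) → ℝ) (hw : ∀ x, 0 ≤ w x)
    (Q : Submodule ℝ (MvPolynomial (ι × Ω) ℝ)) (p : MvPolynomial (ι × Ω) ℝ) :
    ∃ q ∈ Q, ∀ q' ∈ Q, ∑ x, evalPoint x (p - q) * evalPoint x q' * w x = 0 := by
  -- Scaling by the square root of the weight turns the possibly degenerate form into a pullback of
  -- the Euclidean one; the projection takes place in the image.
  let L : MvPolynomial (ι × Ω) ℝ →ₗ[ℝ] EuclideanSpace ℝ (ι → Ω) :=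
    { toFun := fun p => WithLp.toLp 2 fun x => √(w x) * evalPoint x p
      map_add' := by intro a b; ext x; simp [mul_add]
      map_smul' := by intro a b; ext x; simp; ring }
  have hL : ∀ a b, inner ℝ (L a) (L b) = ∑ x, evalPoint x a * evalPoint x b * w x := by
    intro a b
    simp only [PiLp.inner_apply, L, LinearMap.coe_mk, AddHom.coe_mk]
    refine sum_congr rfl fun x _ => ?_
    have := Real.mul_self_sqrt (hw x)
    simp only [RCLike.inner_apply, conj_trivial]
    linear_combination (evalPoint x a * evalPoint x b) * this
  obtain ⟨q, hq, hqL⟩ := Submodule.mem_map.1 ((Q.map L).starProjection_apply_mem (L p))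
  refine ⟨q, hq, fun q' hq' => ?_⟩
  rw [← hL, map_sub, hqL]
  exact Submodule.starProjection_inner_eq_zero _ _ (Submodule.mem_map_of_mem hq')

end Polynomials

end RandomCSP

namespace RandomCSP

open Finset MvPolynomial

namespace FactorSystem

set_option linter.unusedSectionVars false

variable {ι Ω κ : Type*} [Fintype ι] [DecidableEq ι] [Fintype Ω] {k τ : ℕ}

/-! ### The pseudoexpectation -/

/-- The integral against the product of the factors of `U`, relative to the uniform measure. -/
noncomputable def localExp (G : FactorSystem ι Ω κ k τ) (U : Finset κ) (h : (ι → Ω) → ℝ) : ℝ :=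
  (∑ x, h x * G.weight U x) / Fintype.card (ι → Ω)

/-- The functional that integrates each monomial against the factors of the closure `cl A` of its
set `A` of variables. -/
noncomputable def pseudoExp [DecidableEq Ω] (G : FactorSystem ι Ω κ k τ)
    (cl : Finset ι → Finset κ) : MvPolynomial (ι × Ω) ℝ →ₗ[ℝ] ℝ :=
  (basisMonomials (ι × Ω) ℝ).constr ℝ
    fun s => G.localExp (cl (varSet s)) fun x => evalPoint x (monomial s 1)

variable [DecidableEq Ω] [DecidableEq κ] {G : FactorSystem ι Ω κ k τ} {M d : ℕ} {ζ : ℝ}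
  {cl : Finset ι → Finset κ}

theorem pseudoExp_monomial (s : (ι × Ω) →₀ ℕ) :
    G.pseudoExp cl (monomial s 1)
      = G.localExp (cl (varSet s)) fun x => evalPoint x (monomial s 1) := by
  have := (basisMonomials (ι × Ω) ℝ).constr_basis ℝ
    (fun s => G.localExp (cl (varSet s)) fun x => evalPoint x (monomial s 1)) s
  rwa [coe_basisMonomials] at this

/-- Half of the budget suffices for a good set, so the union of two good sets still falls under the
maximality condition of each. -/
theorem IsGood.two_mul_card_le (hG : G.IsExpanding M ζ) (hζ : 0 < ζ) (hd : 4 * (d : ℝ) ≤ ζ * M)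
    {A : Finset ι} {U : Finset κ} (hU : G.IsGood M A U) (hA : #A ≤ d) : 2 * #U ≤ M := by
  have h1 := hU.cheap.card_le hG hU.card_le
  have h2 : (#A : ℝ) ≤ d := by exact_mod_cast hA
  have h3 : ζ * (2 * #U) ≤ ζ * M := by linarith
  exact_mod_cast le_of_mul_le_mul_left h3 hζ

theorem IsGood.localExp_eq (hG : G.IsExpanding M ζ) (hζ : 0 < ζ) (hd : 4 * (d : ℝ) ≤ ζ * M)
    {A A' : Finset ι} {U U' : Finset κ} (hU : G.IsGood M A U) (hU' : G.IsGood M A' U')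
    (hA : #A ≤ d) (hA' : #A' ≤ d) {h : (ι → Ω) → ℝ}
    (hh : DependsOn h ((G.nbhd U ∪ A : Finset ι) : Set ι))
    (hh' : DependsOn h ((G.nbhd U' ∪ A' : Finset ι) : Set ι)) :
    G.localExp U h = G.localExp U' h := by
  have h1 := hU.two_mul_card_le hG hζ hd hA
  have h2 := hU'.two_mul_card_le hG hζ hd hA'
  have h3 : #(U ∪ U') ≤ M := (card_union_le _ _).trans (by omega)
  unfold localExp
  rw [← hU.sum_mul_weight subset_union_left h3 h hh,
    hU'.sum_mul_weight subset_union_right h3 h hh']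

/-- On polynomials in the variables of a good set, the pseudoexpectation is an integral. -/
theorem IsGood.pseudoExp_eq (hG : G.IsExpanding M ζ) (hζ : 0 < ζ) (hd : 4 * (d : ℝ) ≤ ζ * M)
    (hcl : ∀ A, G.IsGood M A (cl A)) {A : Finset ι} {U : Finset κ} (hU : G.IsGood M A U)
    (hA : #A ≤ d) {p : MvPolynomial (ι × Ω) ℝ}
    (hp : p ∈ polyIn {T | T ⊆ G.nbhd U ∪ A ∧ #T ≤ d}) :
    G.pseudoExp cl p = G.localExp U fun x => evalPoint x p := by
  induction hp using Submodule.span_induction with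
  | mem p hp =>
    obtain ⟨s, ⟨hs1, hs2⟩, rfl⟩ := hp
    simp only [pseudoExp_monomial]
    refine (hcl _).localExp_eq hG hζ hd hU hs2 hA ?_ ?_
    · exact (dependsOn_monomial s).mono (by exact_mod_cast subset_union_right)
    · exact (dependsOn_monomial s).mono (by exact_mod_cast hs1)
  | zero => simp [localExp]
  | add p q _ _ hp hq =>
    simp only [map_add, hp, hq, localExp, add_mul, sum_add_distrib, add_div]
  | smul a p _ hp =>
    simp only [map_smul, hp, localExp, smul_eq_mul, mul_assoc, ← mul_sum, mul_div_assoc]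

theorem dependsOn_sum_piecewise {W Y : Finset ι} {g : (ι → Ω) → ℝ}
    (hg : DependsOn g (Y : Set ι)) :
    DependsOn (fun x => ∑ y, g (W.piecewise x y)) ((W ∩ Y : Finset ι) : Set ι) := by
  intro x x' h
  refine sum_congr rfl fun y _ => hg fun i hi => ?_
  by_cases hW : i ∈ W
  · simpa [hW] using h i (mem_coe.2 (mem_inter.2 ⟨hW, hi⟩))
  · simp [hW]

/-- A polynomial in the variables of the good set of `S` that is orthogonal to all functions of
fewer than `#S` of these variables, and to all functions of `T` if `T` consists of such variables,
is orthogonal to all functions of `T`, wherever `T` may be. -/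
theorem pseudoExp_mul_eq_zero [Fintype κ] (hG : G.IsExpanding M ζ) (hζ : 0 < ζ)
    (hd : 4 * (d : ℝ) ≤ ζ * M) (hcl : ∀ A, G.IsGood M A (cl A)) {S T : Finset ι}
    (hS : 2 * #S ≤ d) (hT : #T ≤ #S) {f g : MvPolynomial (ι × Ω) ℝ}
    (hf : f ∈ polyIn {T | T ⊆ G.nbhd (cl S) ∪ S ∧ #T ≤ #S}) (hg : g ∈ polyIn {T})
    (horth : ∀ B ⊆ G.nbhd (cl S) ∪ S, #B < #S ∨ B = T → ∀ b : (ι → Ω) → ℝ,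
      DependsOn b (B : Set ι) → ∑ x, evalPoint x f * b x * G.weight (cl S) x = 0) :
    G.pseudoExp cl (f * g) = 0 := by
  set U := cl S with hUdef
  set W := G.nbhd U ∪ S with hW
  have hU : G.IsGood M S U := hcl S
  -- Cheapness survives enlarging `S` to `S ∪ T`, so the closure of `S` extends to a good set that
  -- can integrate the whole product.
  obtain ⟨U', hUU', hU'⟩ := G.exists_isGood (hU.cheap.mono (subset_union_left (s₂ := T)))
    hU.card_le
  have hST : #(S ∪ T) ≤ d := (card_union_le _ _).trans (by omega)
  have hfd : DependsOn (fun x => evalPoint x f) (W : Set ι) :=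
    dependsOn_of_mem_polyIn (fun T hT => hT.1) hf
  have hgd : DependsOn (fun x => evalPoint x g) (T : Set ι) :=
    dependsOn_of_mem_polyIn (fun T' hT' => (Set.mem_singleton_iff.1 hT').subset) hg
  have hfg : f * g ∈ polyIn {T' | T' ⊆ G.nbhd U' ∪ (S ∪ T) ∧ #T' ≤ d} := by
    refine mul_mem_polyIn ?_ hf hg
    rintro a ⟨ha1, ha2⟩ b rfl
    refine ⟨union_subset (ha1.trans ?_) ?_, (card_union_le _ _).trans (by omega)⟩
    · exact union_subset_union (G.nbhd_mono hUU') subset_union_left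
    · exact subset_union_right.trans subset_union_right
  rw [hU'.pseudoExp_eq hG hζ hd hcl hST hfg]
  unfold localExp
  rw [div_eq_zero_iff]
  left
  obtain ⟨K, hK, ht, hpeel⟩ := G.exists_isTight (W ∪ T) (U' \ U)
  have hwU : DependsOn (G.weight U) (W : Set ι) :=
    (G.dependsOn_weight U).mono (by exact_mod_cast subset_union_left)
  have h1 : ∀ x, evalPoint x (f * g) * G.weight U' x
      = (evalPoint x f * evalPoint x g * G.weight U x) * G.weight (U' \ U) x := by
    intro x
    unfold weight
    rw [← prod_sdiff hUU', map_mul]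
    ring
  simp only [h1]
  have hWT : (W : Set ι) ⊆ ((W ∪ T : Finset ι) : Set ι) := by exact_mod_cast subset_union_left
  have hTT : (T : Set ι) ⊆ ((W ∪ T : Finset ι) : Set ι) := by exact_mod_cast subset_union_right
  rw [hpeel _ (dependsOn_mul (dependsOn_mul (hfd.mono hWT) (hgd.mono hTT)) (hwU.mono hWT))]
  -- The decisive dichotomy. If factors remain, their overlap with `W` is less than the number of
  -- elements of `T` outside `W`, so fewer than `#T` variables are seen; if none remain, only `W ∩
  -- T` is.
  have hB : #(W ∩ (T ∪ G.nbhd K)) < #S ∨ W ∩ (T ∪ G.nbhd K) = T := by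
    have hsplit : #(W ∩ T) + #(T \ W) = #T := by
      rw [inter_comm, card_inter_add_card_sdiff]
    rcases K.eq_empty_or_nonempty with rfl | hne
    · by_cases hTW : T ⊆ W
      · right
        simpa [nbhd] using hTW
      · left
        have : 0 < #(T \ W) := card_pos.2 (sdiff_nonempty.2 hTW)
        simp only [nbhd, biUnion_empty, union_empty]
        omega
    · left
      have hlt := hU.card_inter_lt (disjoint_of_subset_right hK disjoint_sdiff) hne
        ((card_le_card (union_subset hUU' (hK.trans sdiff_subset))).trans hU'.card_le) ht
      rw [inter_union_distrib_left]
      have := card_union_le (W ∩ T) (W ∩ G.nbhd K)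
      rw [← hW] at hlt
      omega
  have hgK : DependsOn (fun x => evalPoint x g * G.weight K x)
      ((T ∪ G.nbhd K : Finset ι) : Set ι) :=
    dependsOn_mul (hgd.mono (by exact_mod_cast subset_union_left))
      ((G.dependsOn_weight K).mono (by exact_mod_cast subset_union_right))
  have h2 := horth _ inter_subset_left hB _ (dependsOn_sum_piecewise (W := W) hgK)
  have h3 := sum_mul_sum_piecewise W (fun x => evalPoint x f * G.weight U x)
    (fun x => evalPoint x g * G.weight K x) (dependsOn_mul hfd hwU)
  have h4 : ∑ x, evalPoint x f * G.weight U x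
      * ∑ y, evalPoint (W.piecewise x y) g * G.weight K (W.piecewise x y) = 0 := by
    rw [← h2]
    exact sum_congr rfl fun x _ => by ring
  rw [h4] at h3
  rcases isEmpty_or_nonempty (ι → Ω) with he | hne
  · simp
  have hcard : (Fintype.card (ι → Ω) : ℝ) ≠ 0 := by
    exact_mod_cast Fintype.card_ne_zero
  rw [← (mul_eq_zero.1 h3.symm).resolve_left hcard]
  exact sum_congr rfl fun x _ => by ring

/-- Positive semidefiniteness, by orthogonalizing one set of variables after the other. -/
theorem pseudoExp_mul_self_nonneg [Fintype κ] (hG : G.IsExpanding M ζ) (hζ : 0 < ζ)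
    (hd : 4 * (d : ℝ) ≤ ζ * M) (hcl : ∀ A, G.IsGood M A (cl A)) (𝒮 : Finset (Finset ι))
    (hsize : ∀ S ∈ 𝒮, 2 * #S ≤ d) (hdown : ∀ S ∈ 𝒮, ∀ T : Finset ι, #T < #S → T ∈ 𝒮)
    {p : MvPolynomial (ι × Ω) ℝ} (hp : p ∈ polyIn (𝒮 : Set (Finset ι))) :
    0 ≤ G.pseudoExp cl (p * p) := by
  induction 𝒮 using Finset.strongInduction generalizing p with
  | H 𝒮 ih =>
    rcases 𝒮.eq_empty_or_nonempty with rfl | hne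
    · have : p = 0 := by simpa [polyIn] using hp
      simp [this]
    -- Removing a set of maximal size keeps all smaller sets available and the family closed
    -- downwards in size.
    obtain ⟨S, hS, hmax⟩ := exists_max_image 𝒮 card hne
    set 𝒯 := 𝒮.erase S with h𝒯
    have hsmall : ∀ T : Finset ι, #T < #S → T ∈ 𝒯 := fun T hT =>
      mem_erase.2 ⟨by rintro rfl; omega, hdown S hS T hT⟩
    have hU : G.IsGood M S (cl S) := hcl S
    set W := G.nbhd (cl S) ∪ S with hW
    have hunion : (𝒮 : Set (Finset ι)) = (𝒯 : Set (Finset ι)) ∪ {S} := by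
      ext T
      simp only [h𝒯, coe_erase, Set.mem_union, Set.mem_sdiff, mem_coe, Set.mem_singleton_iff]
      by_cases h : T = S
      · simp [h, hS]
      · simp [h]
    rw [hunion, polyIn_union] at hp
    obtain ⟨p₁, hp₁, p₂, hp₂, rfl⟩ := Submodule.mem_sup.1 hp
    -- The projection uses sets anywhere in `W`, not only subsets of `S`, since the factors of the
    -- closure correlate `S` with all of `W`.
    obtain ⟨q, hq, hproj⟩ := exists_weighted_projection (G.weight (cl S)) (G.weight_nonneg _)
      (polyIn {T | T ∈ 𝒯 ∧ T ⊆ W}) p₂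
    set f := p₂ - q with hf
    have hfmem : f ∈ polyIn {T | T ⊆ W ∧ #T ≤ #S} := by
      refine Submodule.sub_mem _ (polyIn_mono ?_ hp₂) (polyIn_mono ?_ hq)
      · rintro T rfl
        exact ⟨subset_union_right, le_rfl⟩
      · rintro T ⟨h1, h2⟩
        exact ⟨h2, hmax T (mem_of_mem_erase h1)⟩
    have hq𝒯 : q ∈ polyIn (𝒯 : Set (Finset ι)) := polyIn_mono (fun T hT => hT.1) hq
    have hcross : ∀ g ∈ polyIn (𝒯 : Set (Finset ι)), G.pseudoExp cl (f * g) = 0 := by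
      intro g hg
      induction hg using Submodule.span_induction with
      | mem g hg =>
        obtain ⟨s, hs, rfl⟩ := hg
        have hs' : varSet s ∈ 𝒯 := hs
        refine pseudoExp_mul_eq_zero hG hζ hd hcl (hsize S hS) (hmax _ (mem_of_mem_erase hs'))
          hfmem (monomial_mem_polyIn (C := {varSet s}) (Set.mem_singleton _) 1) ?_
        intro B hB hBT b hb
        obtain ⟨r, hr, hrb⟩ := exists_poly_of_dependsOn hb
        have hr' : r ∈ polyIn {T | T ∈ 𝒯 ∧ T ⊆ W} := by
          refine polyIn_mono ?_ hr
          intro T hT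
          refine ⟨?_, Subset.trans hT hB⟩
          rcases hBT with h | rfl
          · exact hsmall T ((card_le_card hT).trans_lt h)
          · by_cases hTs : T = varSet s
            · rwa [hTs]
            · exact hsmall T ((card_lt_card (Finset.ssubset_iff_subset_ne.2 ⟨hT, hTs⟩)).trans_le
                (hmax _ (mem_of_mem_erase hs')))
        simpa only [hrb] using hproj r hr'
      | zero => simp
      | add a b _ _ ha hb => rw [mul_add, map_add, ha, hb, add_zero]
      | smul c a _ ha => rw [mul_smul_comm, map_smul, ha, smul_zero]
    have hself : 0 ≤ G.pseudoExp cl (f * f) := by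
      have hS2 := hsize S hS
      rw [hU.pseudoExp_eq hG hζ hd hcl (by omega)
        (mul_mem_polyIn (fun a ha b hb => ?_) hfmem hfmem)]
      · refine div_nonneg (sum_nonneg fun x _ => ?_) (Nat.cast_nonneg _)
        beta_reduce
        rw [map_mul]
        exact mul_nonneg (mul_self_nonneg _) (G.weight_nonneg _ _)
      · refine ⟨union_subset ha.1 hb.1, (card_union_le _ _).trans ?_⟩
        have := ha.2
        have := hb.2
        omega
    have hrec := ih 𝒯 (erase_ssubset hS) (fun T hT => hsize T (mem_of_mem_erase hT))
      (fun A hA T hT => hsmall T (hT.trans_le (hmax A (mem_of_mem_erase hA))))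
      (Submodule.add_mem _ hp₁ hq𝒯)
    have hx := hcross _ (Submodule.add_mem _ hp₁ hq𝒯)
    have hexp : (p₁ + p₂) * (p₁ + p₂) = (p₁ + q) * (p₁ + q) + (2 : ℝ) • (f * (p₁ + q)) + f * f := by
      rw [hf, two_smul]
      ring
    rw [hexp, map_add, map_add, map_smul, hx]
    simp only [smul_zero, add_zero]
    exact add_nonneg hrec hself

theorem isPseudoexpectation_pseudoExp [Fintype κ] [Nonempty Ω] (hG : G.IsExpanding M ζ)
    (hζ : 0 < ζ) (hd : 4 * (d : ℝ) ≤ ζ * M) (hcl : ∀ A, G.IsGood M A (cl A)) :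
    IsPseudoexpectation d (G.pseudoExp cl) where
  map_one := by
    have h0 : varSet (0 : (ι × Ω) →₀ ℕ) = ∅ := by simp [varSet]
    have hempty : cl ∅ = ∅ := by
      have := (hcl ∅).cheap.card_le hG (hcl ∅).card_le
      have h1 : ζ * #(cl ∅) ≤ 0 := by simpa using this
      have h2 : (#(cl ∅) : ℝ) ≤ 0 := by
        by_contra h
        push Not at h
        nlinarith
      exact card_eq_zero.1 (by exact_mod_cast le_antisymm h2 (Nat.cast_nonneg _))
    change G.pseudoExp cl (monomial 0 1) = 1
    rw [pseudoExp_monomial, h0, hempty]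
    have hq : (Fintype.card Ω : ℝ) ≠ 0 := by exact_mod_cast Fintype.card_ne_zero
    simp [localExp, weight, evalPoint, hq]
  sq_nonneg p hp := by
    rw [pow_two]
    refine pseudoExp_mul_self_nonneg hG hζ hd hcl (univ.filter fun S => #S ≤ p.totalDegree)
      ?_ ?_ ?_
    · intro S hS
      have := (mem_filter.1 hS).2
      omega
    · intro S hS T hT
      have := (mem_filter.1 hS).2
      simp only [mem_filter, mem_univ, true_and]
      omega
    · simpa using mem_polyIn_of_totalDegree_le (p := p) le_rfl

/-- An identity that holds pointwise, in the presence of the factors, on every monomial multiple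
is satisfied by the pseudoexpectation. -/
theorem satisfiesIdentity_pseudoExp (hG : G.IsExpanding M ζ) (hζ : 0 < ζ)
    (hd : 4 * (d : ℝ) ≤ ζ * M) (hcl : ∀ A, G.IsGood M A (cl A)) {B : Finset ι}
    {p : MvPolynomial (ι × Ω) ℝ} (hp : p ∈ polyIn {T | T ⊆ B}) (hB : #B ≤ p.totalDegree)
    (h0 : ∀ A, B ⊆ A → #A ≤ d → ∀ x, evalPoint x p * G.weight (cl A) x = 0) :
    SatisfiesIdentity d (G.pseudoExp cl) p := by
  intro r hr
  have hmain : ∀ s ∈ r.support, G.pseudoExp cl (p * monomial s 1) = 0 := by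
    intro s hs
    have hcard : #(B ∪ varSet s) ≤ d := by
      -- The size of `B` is charged to the degree of `p`, so the joint variable set stays within
      -- `d`.
      have h1 := card_union_le B (varSet s)
      have h2 := card_varSet_le s
      have h3 := le_totalDegree hs
      omega
    rw [(hcl (B ∪ varSet s)).pseudoExp_eq hG hζ hd hcl hcard]
    · unfold localExp
      rw [sum_eq_zero, zero_div]
      intro x _
      beta_reduce
      rw [map_mul, mul_right_comm, h0 _ subset_union_left hcard, zero_mul]
    · refine mul_mem_polyIn ?_ hp (monomial_mem_polyIn (C := {varSet s}) (Set.mem_singleton _) 1)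
      rintro a ha b rfl
      have hab : a ∪ varSet s ⊆ B ∪ varSet s := union_subset_union ha Subset.rfl
      exact ⟨hab.trans subset_union_right, (card_le_card hab).trans hcard⟩
  rw [r.as_sum, mul_sum, map_sum]
  refine sum_eq_zero fun s hs => ?_
  have : monomial s (coeff s r) = coeff s r • monomial s (1 : ℝ) := by simp [smul_monomial]
  rw [this, mul_smul_comm, map_smul, hmain s hs, smul_zero]

/-- Factors all of whose coordinates lie in `A` belong to the good set of `A`. -/
theorem IsGood.mem_of_scope_subset (hG : G.IsExpanding M ζ) (hζ : 0 < ζ)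
    (hd : 4 * (d : ℝ) ≤ ζ * M) (hd0 : 0 < d) (hτ : τ ≤ 2 * k) {A : Finset ι} {U : Finset κ}
    (hU : G.IsGood M A U) (hA : #A ≤ d) {f : κ} (hf : G.scope f ⊆ A) : f ∈ U := by
  by_contra hfU
  have h1 := hU.two_mul_card_le hG hζ hd hA
  have hM : 0 < M := by
    rcases Nat.eq_zero_or_pos M with rfl | h
    · have : (0 : ℝ) < d := by exact_mod_cast hd0
      simp at hd
      linarith
    · exact h
  -- Adding `f` brings in no coordinate outside `A`, so cheapness persists because `τ ≤ 2 * k`,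
  -- contradicting maximality.
  refine hU.maximal (insert f U) (ssubset_insert hfU) ?_ ?_
  · rw [card_insert_of_notMem hfU]
    omega
  · have h2 := hU.cheap
    unfold IsCheap at *
    have h3 : G.nbhd (insert f U) \ A ⊆ G.nbhd U \ A := by
      intro v
      simp only [nbhd, biUnion_insert, mem_sdiff, mem_union]
      rintro ⟨h | h, h'⟩
      · exact absurd (hf h) h'
      · exact ⟨h, h'⟩
    have h4 := card_le_card h3
    rw [card_insert_of_notMem hfU]
    have e1 := mul_add τ #U 1
    have e2 := mul_add (2 * k) #U 1
    omega

end FactorSystem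

end RandomCSP

namespace RandomCSP

open Finset MvPolynomial

/-! ### Complexity -/

section Complexity

variable {Ω : Type*} [Fintype Ω] [DecidableEq Ω] {k : ℕ} {P : Predicate Ω k}

/-- Pulling the distribution back along the coordinatewise permutation preserves every uniform
marginal. -/
theorem SupportsUniform.of_mem_literalFamily {t : ℕ} (h : SupportsUniform P t)
    {L : Set (Equiv.Perm Ω)} {Q : Predicate Ω k} (hQ : Q ∈ literalFamily P L) :
    SupportsUniform Q t := by
  obtain ⟨ℓ, -, rfl⟩ := hQ
  obtain ⟨μ, ⟨hμ0, hμ1⟩, hμ, hμP⟩ := h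
  let e : (Fin k → Ω) ≃ (Fin k → Ω) := Equiv.piCongrRight ℓ
  have he : ∀ x, e x = fun i => ℓ i (x i) := fun x => rfl
  refine ⟨fun x => μ (e x), ⟨fun x => hμ0 _, ?_⟩, ?_, fun x hx => hμP _ hx⟩
  · rw [e.sum_comp μ, hμ1]
  · intro T hT y
    rw [← hμ T hT (e y)]
    refine sum_equiv e (fun x => ?_) fun x _ => rfl
    simp [he]

/-- The only `k`-wise uniform distribution is the uniform one, which charges every point. -/
theorem not_supportsUniform_self (hP : ∃ x, P x = false) : ¬ SupportsUniform P k := by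
  rintro ⟨μ, -, hμ, hμP⟩
  obtain ⟨x, hx⟩ := hP
  have h := hμ univ (by simp) x
  have h1 : (univ.filter fun z : Fin k → Ω => ∀ i ∈ (univ : Finset (Fin k)), z i = x i) = {x} := by
    ext z
    simp [funext_iff]
  have h2 : μ x = ((Fintype.card Ω : ℝ) ^ k)⁻¹ := by
    rw [← h, h1, sum_singleton]
  rw [hμP x hx] at h2
  rcases Nat.eq_zero_or_pos k with rfl | hk
  · simp at h2
  · have : Nonempty Ω := ⟨x ⟨0, hk⟩⟩
    have : (0 : ℝ) < ((Fintype.card Ω : ℝ) ^ k)⁻¹ := by positivity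
    linarith

theorem complexity_mem (hk : 3 ≤ k) (hP : ∃ x, P x = false) :
    3 ≤ complexity P ∧ complexity P ≤ k ∧ ¬ SupportsUniform P (complexity P) :=
  Nat.sInf_mem (s := {τ | 3 ≤ τ ∧ τ ≤ k ∧ ¬ SupportsUniform P τ})
    ⟨k, hk, le_rfl, not_supportsUniform_self hP⟩

theorem supportsUniform_complexity_sub_one (hk : 3 ≤ k) (hP : ∃ x, P x = false)
    (h2 : SupportsUniform P 2) : SupportsUniform P (complexity P - 1) := by
  obtain ⟨h3, hle, -⟩ := complexity_mem hk hP
  -- The minimum starts at three, so minimality says nothing about two; there the pairwise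
  -- hypothesis is needed.
  rcases h3.eq_or_lt with h | h
  · rwa [← h]
  · by_contra hcon
    have : complexity P ≤ complexity P - 1 := Nat.sInf_le ⟨by omega, by omega, hcon⟩
    omega

end Complexity

/-! ### Expanding instances -/

section Instances

set_option linter.unusedSectionVars false

variable {Ω : Type*} [Fintype Ω] [DecidableEq Ω] {k n m : ℕ}

theorem one_le_totalDegree_of_eval_ne {σ : Type*} {p : MvPolynomial σ ℝ} {a b : σ → ℝ}
    (h : eval a p ≠ eval b p) : 1 ≤ p.totalDegree := by
  by_contra hlt
  have h0 : p.totalDegree = 0 := by omega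
  rw [totalDegree_eq_zero_iff_eq_C.1 h0] at h
  simp at h

/-- Distinct monomials of degree `k` with coefficient one cannot cancel. The bound ensures that
whenever the identity must be checked, the scope fits into the degree budget. -/
theorem le_totalDegree_satPoly_sub_one {Q : Predicate Ω k} (hk : 0 < k) (hQ : ∃ c, Q c = true)
    (S : Fin k ↪ Fin n) : k ≤ (satPoly Q S - 1).totalDegree := by
  have hhom : (satPoly Q S).IsHomogeneous k := by
    refine IsHomogeneous.sum _ _ _ fun c _ => ?_
    have := IsHomogeneous.prod univ (fun j => (X (S j, c j) : MvPolynomial (Fin n × Ω) ℝ))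
      (fun _ => 1) (fun j _ => isHomogeneous_X _ _)
    simpa using this
  have hne : satPoly Q S ≠ 0 := by
    intro h0
    have h1 : eval (fun _ => (1 : ℝ)) (satPoly Q S) = 0 := by rw [h0]; simp
    obtain ⟨c, hc⟩ := hQ
    simp only [satPoly, map_sum, map_prod, eval_X, prod_const_one, sum_const, nsmul_eq_mul,
      mul_one, Nat.cast_eq_zero, card_eq_zero] at h1
    have : c ∈ (univ.filter fun c => Q c = true) := by simp [hc]
    rw [h1] at this
    simp at this
  have hdeg := hhom.totalDegree hne
  rw [sub_eq_add_neg, totalDegree_add_eq_left_of_totalDegree_lt, hdeg]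
  rw [hdeg, totalDegree_neg, totalDegree_one]
  exact hk

theorem evalPoint_satPoly (Q : Predicate Ω k) (S : Fin k ↪ Fin n) (x : Fin n → Ω) :
    evalPoint x (satPoly Q S) = if Q (x ∘ S) = true then 1 else 0 := by
  have h : ∀ c : Fin k → Ω, (∏ j, if x (S j) = c j then (1 : ℝ) else 0)
      = if x ∘ S = c then 1 else 0 := by
    intro c
    rw [prod_ite_zero]
    simp [funext_iff]
  simp only [satPoly, map_sum, map_prod, evalPoint_X, h]
  rw [sum_filter]
  simp only [← ite_and]
  split_ifs with hQ
  · rw [sum_eq_single (x ∘ S)]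
    · simp [hQ]
    · intro c _ hc
      simp [Ne.symm hc]
    · simp
  · refine sum_eq_zero fun c _ => ?_
    rw [if_neg]
    rintro ⟨hc, rfl⟩
    exact hQ hc

theorem satPoly_mem_polyIn (Q : Predicate Ω k) (S : Fin k ↪ Fin n) :
    satPoly Q S ∈ polyIn {T | T ⊆ univ.map S} := by
  refine Submodule.sum_mem _ fun c _ => ?_
  have hprod : ∀ J : Finset (Fin k), (∏ j ∈ J, X (S j, c j) : MvPolynomial (Fin n × Ω) ℝ)
      ∈ polyIn {T | T ⊆ univ.map S} := by
    intro J
    induction J using Finset.induction_on with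
    | empty =>
      rw [prod_empty]
      exact one_mem_polyIn (empty_subset _)
    | insert j J hj ih =>
      rw [prod_insert hj]
      refine mul_mem_polyIn (C := {T | T ⊆ univ.map S}) (C' := {T | T ⊆ univ.map S})
        (fun a ha b hb => union_subset ha hb) (X_mem_polyIn ?_ _) ih
      simp
  exact hprod univ

/-- Instances all of whose small sets of constraints involve many variables are not refuted. -/
theorem sosFailsToRefute_of_expanding [Nonempty Ω] {F : Set (Predicate Ω k)} {τ M d : ℕ} {ζ : ℝ}
    (hτ : 0 < τ) (hτk : τ ≤ k) (hF : ∀ Q ∈ F, SupportsUniform Q (τ - 1)) (hζ : 0 < ζ)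
    (hd : 4 * (d : ℝ) ≤ ζ * M) (I : CSPInstance F n m)
    (hexp : ∀ U : Finset (Fin m), #U ≤ M →
      (2 * k + ζ) * #U ≤ 2 * #(U.biUnion fun f => univ.map (I f).2) + τ * #U) :
    SOSFailsToRefute d I := by
  choose μ hμ hμu hμP using fun f => hF _ (I f).1.2
  let G : FactorSystem (Fin n) Ω (Fin m) k τ :=
    { scope := fun f => univ.map (I f).2
      density := fun f x => (Fintype.card Ω : ℝ) ^ k * μ f (x ∘ (I f).2)
      card_scope := fun f => by simp
      density_nonneg := fun f x => mul_nonneg (by positivity) ((hμ f).1 _)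
      dependsOn_density := by
        intro f x y h
        have : x ∘ (I f).2 = y ∘ (I f).2 := by
          ext j
          exact h _ (by simp)
        simp only [this]
      sum_mul_density := fun f R hR g hg =>
        (hμu f).sum_mul_density (by omega) (I f).2 R (by omega) g hg }
  have hG : G.IsExpanding M ζ := hexp
  have hcl : ∀ A, ∃ U, G.IsGood M A U := fun A =>
    let ⟨U, _, hU⟩ := G.exists_isGood (G.isCheap_empty A) (Nat.zero_le M)
    ⟨U, hU⟩
  choose cl hcl using hcl
  refine ⟨G.pseudoExp cl, FactorSystem.isPseudoexpectation_pseudoExp hG hζ hd hcl, ?_, ?_, ?_⟩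
  · intro i
    have hX : ∀ c, (X (i, c) : MvPolynomial (Fin n × Ω) ℝ) ∈ polyIn {T | T ⊆ {i}} := fun c =>
      X_mem_polyIn (Subset.refl _) c
    refine FactorSystem.satisfiesIdentity_pseudoExp hG hζ hd hcl (B := {i})
      (Submodule.sub_mem _ (Submodule.sum_mem _ fun c _ => hX c)
        (one_mem_polyIn (empty_subset _))) ?_ ?_
    · rw [card_singleton]
      apply one_le_totalDegree_of_eval_ne (a := 0) (b := 1)
      have hq : (0 : ℝ) < Fintype.card Ω := by exact_mod_cast Fintype.card_pos
      intro h
      simp at h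
      linarith
    · intro A _ _ x
      simp [evalPoint_X]
  · intro i c
    have hX : (X (i, c) : MvPolynomial (Fin n × Ω) ℝ) ∈ polyIn {T | T ⊆ {i}} :=
      X_mem_polyIn (Subset.refl _) c
    refine FactorSystem.satisfiesIdentity_pseudoExp hG hζ hd hcl (B := {i})
      (Submodule.sub_mem _ ?_ hX) ?_ ?_
    · rw [pow_two]
      exact mul_mem_polyIn (fun a ha b hb => union_subset ha hb) hX hX
    · rw [card_singleton]
      apply one_le_totalDegree_of_eval_ne (a := 0) (b := fun _ => 2)
      norm_num
    · intro A _ _ x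
      simp [evalPoint_X]
  · intro f
    have hsat : ∃ c, (I f).1.1 c = true := by
      by_contra hcon
      push Not at hcon
      have h0 : ∀ x, μ f x = 0 := fun x => hμP f x (by simpa using hcon x)
      have := (hμ f).2
      simp [h0] at this
    refine FactorSystem.satisfiesIdentity_pseudoExp hG hζ hd hcl (B := univ.map (I f).2)
      (Submodule.sub_mem _ (satPoly_mem_polyIn _ _) (one_mem_polyIn (empty_subset _))) ?_ ?_
    · rw [card_map, card_univ, Fintype.card_fin]
      exact le_totalDegree_satPoly_sub_one (by omega) hsat _
    · intro A hA hAd x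
      have hkd : k ≤ d := by
        have := card_le_card hA
        rw [card_map, card_univ, Fintype.card_fin] at this
        omega
      have hf : f ∈ cl A :=
        (hcl A).mem_of_scope_subset hG hζ hd (by omega) (by omega) hAd hA
      rw [map_sub, evalPoint_satPoly, map_one]
      by_cases hQ : (I f).1.1 (x ∘ (I f).2) = true
      · simp [hQ]
      · have : G.weight (cl A) x = 0 := by
          refine prod_eq_zero hf ?_
          change (Fintype.card Ω : ℝ) ^ k * μ f (x ∘ (I f).2) = 0
          rw [hμP f _ (by simpa using hQ), mul_zero]
        rw [this, mul_zero]

end Instances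

end RandomCSP

namespace RandomCSP

open Finset

/-! ### Numerical estimates -/

section Estimates

theorem choose_le_mul_exp_pow (m c : ℕ) (hc : 0 < c) :
    (m.choose c : ℝ) ≤ (m / c * Real.exp 1) ^ c := by
  have h1 : (m.choose c : ℝ) ≤ (m : ℝ) ^ c / c.factorial := Nat.choose_le_pow_div c m
  have h2 : (c : ℝ) ^ c / c.factorial ≤ Real.exp c :=
    Real.pow_div_factorial_le_exp _ (Nat.cast_nonneg c) c
  have hc' : (0 : ℝ) < c := by exact_mod_cast hc
  have hf : (0 : ℝ) < c.factorial := by exact_mod_cast c.factorial_pos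
  refine h1.trans ?_
  rw [mul_pow, div_pow, ← Real.exp_nat_mul, mul_one]
  calc (m : ℝ) ^ c / c.factorial = (m : ℝ) ^ c / (c : ℝ) ^ c * ((c : ℝ) ^ c / c.factorial) := by
        field_simp
    _ ≤ _ := by gcongr

theorem choose_mul_div_pow_le_exp (n v : ℕ) (hn : 0 < n) :
    (n.choose v : ℝ) * ((v : ℝ) / n) ^ v ≤ Real.exp v := by
  have h1 : (n.choose v : ℝ) ≤ (n : ℝ) ^ v / v.factorial := Nat.choose_le_pow_div v n
  have h2 : (v : ℝ) ^ v / v.factorial ≤ Real.exp v :=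
    Real.pow_div_factorial_le_exp _ (Nat.cast_nonneg v) v
  have hn' : (0 : ℝ) < n := by exact_mod_cast hn
  have hf : (0 : ℝ) < v.factorial := by exact_mod_cast v.factorial_pos
  refine le_trans ?_ h2
  calc (n.choose v : ℝ) * ((v : ℝ) / n) ^ v ≤ (n : ℝ) ^ v / v.factorial * ((v : ℝ) / n) ^ v := by
        gcongr
    _ = _ := by
        rw [div_pow]
        field_simp

/-- The expected number of sets of `c` constraints on `v` variables. -/
theorem union_bound_term_le {k n m c v : ℕ} {Δ θ : ℝ} (hk : 0 < k) (hn : 0 < n) (hc : 0 < c)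
    (hm : (m : ℝ) = Δ * n) (hθ : 0 ≤ θ) (hv : (v : ℝ) ≤ (k - θ) * c)
    (hy : (k * c : ℝ) / n ≤ 1) :
    (m.choose c : ℝ) * (n.choose v * (((v : ℝ) / n) ^ k) ^ c)
      ≤ (Real.exp (k + 1) * k * Δ * ((k * c : ℝ) / n) ^ (θ - 1)) ^ c := by
  have hc' : (0 : ℝ) < c := by exact_mod_cast hc
  have hk' : (0 : ℝ) < k := by exact_mod_cast hk
  have hn' : (0 : ℝ) < n := by exact_mod_cast hn
  set y : ℝ := (k * c : ℝ) / n with hydef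
  have hy0 : 0 < y := by positivity
  have hvk : (v : ℝ) ≤ (k * c : ℕ) := by
    push_cast
    nlinarith
  have hvk' : v ≤ k * c := by exact_mod_cast hvk
  have hvy : (v : ℝ) / n ≤ y := by
    rw [hydef]
    gcongr
    exact_mod_cast hvk'
  have h1 : (n.choose v : ℝ) * (((v : ℝ) / n) ^ k) ^ c ≤ Real.exp (k * c) * (y ^ θ) ^ c := by
    rw [← pow_mul]
    -- The first `v` factors cancel the binomial coefficient up to `exp v`; the remaining ones, at
    -- least `θ * c` in number, are each at most `y`.
    have hsplit : ((v : ℝ) / n) ^ (k * c) = ((v : ℝ) / n) ^ v * ((v : ℝ) / n) ^ (k * c - v) := by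
      rw [← pow_add]
      congr 1
      omega
    rw [hsplit, ← mul_assoc]
    have h2 : ((v : ℝ) / n) ^ (k * c - v) ≤ (y ^ θ) ^ c := by
      calc ((v : ℝ) / n) ^ (k * c - v) ≤ y ^ (k * c - v) := by gcongr
        _ = y ^ (((k * c - v : ℕ) : ℝ)) := (Real.rpow_natCast _ _).symm
        _ ≤ y ^ (θ * c) := by
            apply Real.rpow_le_rpow_of_exponent_ge hy0 hy
            rw [Nat.cast_sub hvk']
            push_cast
            nlinarith
        _ = (y ^ θ) ^ c := by rw [Real.rpow_mul hy0.le, Real.rpow_natCast]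
    have h3 : (n.choose v : ℝ) * ((v : ℝ) / n) ^ v ≤ Real.exp (k * c) :=
      (choose_mul_div_pow_le_exp n v hn).trans (Real.exp_le_exp.2 (by exact_mod_cast hvk))
    gcongr
  have h4 := choose_le_mul_exp_pow m c hc
  calc (m.choose c : ℝ) * (n.choose v * (((v : ℝ) / n) ^ k) ^ c)
      ≤ (m / c * Real.exp 1) ^ c * (Real.exp (k * c) * (y ^ θ) ^ c) := by gcongr
    _ = (m / c * Real.exp 1 * (Real.exp k * y ^ θ)) ^ c := by
        rw [mul_comm (k : ℝ) c, Real.exp_nat_mul, ← mul_pow, ← mul_pow]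
    _ = _ := by
        congr 1
        rw [Real.rpow_sub_one hy0.ne', Real.exp_add, hm, hydef]
        field_simp

theorem two_le_log {Δ : ℝ} (hΔ : 10 ≤ Δ) : 2 ≤ Real.log Δ := by
  rw [Real.le_log_iff_exp_le (by linarith)]
  have h1 := Real.exp_one_lt_d9
  have h2 : Real.exp 2 = Real.exp 1 * Real.exp 1 := by
    rw [← Real.exp_add]
    norm_num
  have h3 := Real.exp_pos 1
  rw [h2]
  nlinarith

/-- The exponent `s` of `y` is at least `τ / 12`, so `108 = 9 * 12` yields a factor at most `β` and
a factor at most `2 ^ (-9k)`. The latter beats the remaining constants, at most `2 ^ (8k)`, with `2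
^ (-k)` to spare. -/
theorem base_le_half {k τ : ℕ} {Δ β ζ y : ℝ} (hτ : 3 ≤ τ) (hτk : τ ≤ k) (hΔ : 10 ≤ Δ)
    (hβ : 0 < β) (hβ1 : β < 1) (hζ : ζ = 1 / Real.log Δ) (hy0 : 0 ≤ y)
    (hy : y ≤ 8 * β ^ ((108 : ℝ) / τ) * (2 : ℝ) ^ (-(108 * k / τ : ℝ))
      * Δ ^ (-(2 / ((τ : ℝ) - 2)))) :
    Real.exp (k + 1) * k * Δ * y ^ ((τ - ζ) / 2 - 1) ≤ β / 2 := by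
  have hlog := two_le_log hΔ
  have hτ' : (3 : ℝ) ≤ τ := by exact_mod_cast hτ
  have hτk' : (τ : ℝ) ≤ k := by exact_mod_cast hτk
  have hζ0 : 0 < ζ := by rw [hζ]; positivity
  have hζ1 : ζ ≤ 1 / 2 := by
    rw [hζ]
    exact one_div_le_one_div_of_le (by norm_num) hlog
  set s : ℝ := (τ - ζ) / 2 - 1 with hs
  have hs0 : 0 ≤ s := by rw [hs]; linarith
  have hsk : s ≤ k := by rw [hs]; linarith
  have hΔ0 : 0 < Δ := by linarith
  have hsτ : 1 / 12 ≤ s / τ := by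
    rw [div_le_div_iff₀ (by norm_num) (by linarith), hs]
    linarith
  have hpow := Real.rpow_le_rpow hy0 hy hs0
  rw [Real.mul_rpow (by positivity) (by positivity), Real.mul_rpow (by positivity) (by positivity),
    Real.mul_rpow (by positivity) (by positivity), ← Real.rpow_mul hβ.le,
    ← Real.rpow_mul (by norm_num), ← Real.rpow_mul hΔ0.le] at hpow
  have b8 : (8 : ℝ) ^ s ≤ (2 : ℝ) ^ (3 * k : ℝ) := by
    rw [Real.rpow_mul (by norm_num)]
    norm_num
    calc (8 : ℝ) ^ s ≤ (8 : ℝ) ^ (k : ℝ) := Real.rpow_le_rpow_of_exponent_le (by norm_num) hsk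
      _ = _ := by norm_num
  have bβ : β ^ ((108 : ℝ) / τ * s) ≤ β := by
    calc β ^ ((108 : ℝ) / τ * s) ≤ β ^ (1 : ℝ) := by
          apply Real.rpow_le_rpow_of_exponent_ge hβ hβ1.le
          have : (108 : ℝ) / τ * s = 108 * (s / τ) := by ring
          rw [this]
          linarith
      _ = β := Real.rpow_one β
  have b2 : (2 : ℝ) ^ (-(108 * k / τ : ℝ) * s) ≤ (2 : ℝ) ^ (-(9 * k) : ℝ) := by
    apply Real.rpow_le_rpow_of_exponent_le (by norm_num)
    have : -(108 * k / τ : ℝ) * s = -(108 * k * (s / τ)) := by ring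
    rw [this, neg_le_neg_iff]
    nlinarith
  -- The exponent of `Δ` would cancel exactly for `ζ = 0`; the excess is at most `ζ`, and `Δ ^ ζ =
  -- e`.
  have bΔ : Δ * Δ ^ (-(2 / ((τ : ℝ) - 2)) * s) ≤ Real.exp 1 := by
    have h2 : (0 : ℝ) < (τ : ℝ) - 2 := by linarith
    have e1 : Δ * Δ ^ (-(2 / ((τ : ℝ) - 2)) * s) = Δ ^ (ζ / ((τ : ℝ) - 2)) := by
      nth_rewrite 1 [← Real.rpow_one Δ]
      rw [← Real.rpow_add hΔ0]
      congr 1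
      rw [hs]
      field_simp
      ring
    rw [e1]
    calc Δ ^ (ζ / ((τ : ℝ) - 2)) ≤ Δ ^ ζ := by
          apply Real.rpow_le_rpow_of_exponent_le (by linarith)
          exact div_le_self hζ0.le (by linarith)
      _ = Real.exp 1 := by
          rw [Real.rpow_def_of_pos hΔ0, hζ]
          congr 1
          field_simp
  have bk : (k : ℝ) ≤ (2 : ℝ) ^ (k : ℝ) := by
    rw [Real.rpow_natCast]
    exact_mod_cast (Nat.lt_two_pow_self (n := k)).le
  have be : Real.exp (k + 1) * Real.exp 1 ≤ (2 : ℝ) ^ (4 * k : ℝ) := by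
    have he : Real.exp 1 ≤ 4 := by
      have := Real.exp_one_lt_d9
      linarith
    have e1 : Real.exp (k + 1) * Real.exp 1 = Real.exp 1 ^ (k + 2) := by
      rw [← Real.exp_add, ← Real.exp_nat_mul]
      congr 1
      push_cast
      ring
    rw [e1]
    calc Real.exp 1 ^ (k + 2) ≤ 4 ^ (k + 2) := by gcongr
      _ = (2 : ℝ) ^ (2 * (k + 2)) := by rw [pow_mul]; norm_num
      _ ≤ (2 : ℝ) ^ (4 * k) := by
          apply pow_le_pow_right₀ (by norm_num)
          omega
      _ = _ := by
          rw [← Real.rpow_natCast]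
          push_cast
          rfl
  calc Real.exp (k + 1) * k * Δ * y ^ s
      ≤ Real.exp (k + 1) * k * Δ * ((8 : ℝ) ^ s * β ^ ((108 : ℝ) / τ * s)
        * (2 : ℝ) ^ (-(108 * k / τ : ℝ) * s) * Δ ^ (-(2 / ((τ : ℝ) - 2)) * s)) := by gcongr
    _ = Real.exp (k + 1) * (Δ * Δ ^ (-(2 / ((τ : ℝ) - 2)) * s)) * k * (8 : ℝ) ^ s
        * (2 : ℝ) ^ (-(108 * k / τ : ℝ) * s) * β ^ ((108 : ℝ) / τ * s) := by ring
    _ ≤ Real.exp (k + 1) * Real.exp 1 * (2 : ℝ) ^ (k : ℝ) * (2 : ℝ) ^ (3 * k : ℝ)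
        * (2 : ℝ) ^ (-(9 * k) : ℝ) * β := by gcongr
    _ ≤ (2 : ℝ) ^ (4 * k : ℝ) * (2 : ℝ) ^ (k : ℝ) * (2 : ℝ) ^ (3 * k : ℝ)
        * (2 : ℝ) ^ (-(9 * k) : ℝ) * β := by gcongr
    _ = (2 : ℝ) ^ (-(k : ℝ)) * β := by
        rw [← Real.rpow_add (by norm_num), ← Real.rpow_add (by norm_num),
          ← Real.rpow_add (by norm_num)]
        congr 2
        ring
    _ ≤ (2 : ℝ) ^ (-1 : ℝ) * β := by
        gcongr
        · norm_num
        · linarith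
    _ = β / 2 := by
        rw [Real.rpow_neg_one]
        ring

theorem sum_half_pow_le {β : ℝ} (hβ : 0 < β) (hβ1 : β < 1) (M : ℕ) :
    ∑ c ∈ Icc 1 M, (β / 2) ^ c ≤ β := by
  have h : ∀ M : ℕ, ∑ c ∈ Icc 1 M, (β / 2) ^ c ≤ β * (1 - (1 / 2) ^ M) := by
    intro M
    induction M with
    | zero => simp
    | succ M ih =>
      rw [sum_Icc_succ_top (by omega)]
      have h1 : (β / 2) ^ (M + 1) ≤ β * (1 / 2) ^ (M + 1) := by
        rw [div_eq_mul_one_div, mul_pow]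
        gcongr
        exact pow_le_of_le_one hβ.le hβ1.le (by omega)
      have h2 : ((1 : ℝ) / 2) ^ (M + 1) = (1 / 2) ^ M / 2 := by rw [pow_succ]; ring
      rw [h2] at h1 ⊢
      linarith
  refine (h M).trans ?_
  have : (0 : ℝ) ≤ (1 / 2) ^ M := by positivity
  nlinarith

end Estimates

end RandomCSP

namespace RandomCSP

open Finset

/-! ### The union bound -/

section Probability

theorem uniformProb_mono {α : Type*} [Finite α] {A B : Set α} (h : A ⊆ B) :
    uniformProb A ≤ uniformProb B := by
  unfold uniformProb
  gcongr
  exact Set.toFinite B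

theorem uniformProb_biUnion_le {α ι : Type*} [Finite α] (s : Finset ι) (A : ι → Set α) :
    uniformProb (⋃ i ∈ s, A i) ≤ ∑ i ∈ s, uniformProb (A i) := by
  unfold uniformProb
  rw [← sum_div]
  gcongr
  exact_mod_cast Finset.set_ncard_biUnion_le s A

/-- The entries are independent: the event is a product set, and coordinates outside `U` contribute
one. -/
theorem uniformProb_pi_le {α : Type*} [Finite α] {m : ℕ} {r : ℝ} (hr : 0 ≤ r) (B : Set α)
    (hB : uniformProb B ≤ r) (U : Finset (Fin m)) :
    uniformProb {I : Fin m → α | ∀ f ∈ U, I f ∈ B} ≤ r ^ #U := by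
  classical
  cases nonempty_fintype α
  rcases isEmpty_or_nonempty (Fin m → α) with he | hne
  · simp only [uniformProb, Nat.card_of_isEmpty, Nat.cast_zero, div_zero]
    positivity
  have hset : {I : Fin m → α | ∀ f ∈ U, I f ∈ B}
      = (Fintype.piFinset fun f => if f ∈ U then B.toFinset else univ : Finset (Fin m → α)) := by
    ext I
    simp only [Set.mem_ofPred_eq, mem_coe, Fintype.mem_piFinset]
    refine forall_congr' fun f => ?_
    by_cases h : f ∈ U <;> simp [h]
  have hcard : (Nat.card (Fin m → α) : ℝ) = ∏ _f : Fin m, (Fintype.card α : ℝ) := by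
    simp
  unfold uniformProb at hB ⊢
  rw [hset, Set.ncard_coe_finset, Fintype.card_piFinset, hcard, Nat.cast_prod, ← prod_div_distrib]
  have hprod : r ^ #U = ∏ f : Fin m, if f ∈ U then r else 1 := by simp
  rw [hprod]
  refine prod_le_prod (fun f _ => by positivity) fun f _ => ?_
  have hα : (Fintype.card α : ℝ) ≠ 0 := by
    have : Nonempty α := ⟨hne.some f⟩
    exact_mod_cast Fintype.card_ne_zero
  split_ifs
  · rwa [← Set.ncard_eq_toFinset_card', ← Nat.card_eq_fintype_card]
  · rw [card_univ, div_self hα]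

/-- Sampling without replacement only helps: each ratio `(v - i) / (n - i)` is at most `v / n`. -/
theorem descFactorial_mul_pow_le {v n : ℕ} (h : v ≤ n) (k : ℕ) :
    v.descFactorial k * n ^ k ≤ v ^ k * n.descFactorial k := by
  induction k with
  | zero => simp
  | succ k ih =>
    rw [Nat.descFactorial_succ, Nat.descFactorial_succ, pow_succ, pow_succ]
    have h1 : (v - k) * n ≤ v * (n - k) := by
      rw [Nat.sub_mul, Nat.mul_sub]
      have : k * v ≤ k * n := Nat.mul_le_mul_left k h
      have := mul_comm v k
      omega
    calc (v - k) * v.descFactorial k * (n ^ k * n)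
        = ((v - k) * n) * (v.descFactorial k * n ^ k) := by ring
      _ ≤ (v * (n - k)) * (v ^ k * n.descFactorial k) := Nat.mul_le_mul h1 ih
      _ = _ := by ring

/-- The probability that all variables of a random scope lie in `V`. -/
theorem uniformProb_scope_le {Ω : Type*} [Finite Ω] {k n : ℕ} (F : Set (Predicate Ω k))
    (hn : 0 < n) (V : Finset (Fin n)) :
    uniformProb {p : F × (Fin k ↪ Fin n) | ∀ j, p.2 j ∈ V} ≤ ((#V : ℝ) / n) ^ k := by
  classical
  cases nonempty_fintype Ω
  have hset : {p : F × (Fin k ↪ Fin n) | ∀ j, p.2 j ∈ V}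
      = (Set.univ : Set F) ×ˢ {S : Fin k ↪ Fin n | ∀ j, S j ∈ V} := by
    ext p
    simp
  have hinj : {S : Fin k ↪ Fin n | ∀ j, S j ∈ V}.ncard ≤ (#V).descFactorial k := by
    have h1 : Fintype.card (Fin k ↪ V) = (#V).descFactorial k := by simp
    rw [← h1, ← Nat.card_eq_fintype_card, ← Nat.card_coe_set_eq]
    refine Nat.card_le_card_of_injective
      (fun S => Function.Embedding.codRestrict (V : Set (Fin n)) S.1 S.2) ?_
    intro S S' h
    ext j
    have := congrArg (fun e : Fin k ↪ V => ((e j : Fin n) : ℕ)) h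
    exact this
  unfold uniformProb
  rw [hset, Set.ncard_prod, Set.ncard_univ, Nat.card_prod]
  push_cast
  rcases eq_or_ne (Nat.card F : ℝ) 0 with h0 | h0
  · rw [h0]
    simp
    positivity
  rw [mul_div_mul_left _ _ h0]
  have hcard : Nat.card (Fin k ↪ Fin n) = n.descFactorial k := by simp
  rw [hcard]
  rcases Nat.eq_zero_or_pos (n.descFactorial k) with hz | hpos
  · rw [hz]
    simp
    positivity
  have hV : #V ≤ n := by simpa using card_le_univ V
  have hmain := descFactorial_mul_pow_le hV k
  have hn' : (0 : ℝ) < n := by exact_mod_cast hn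
  have hpos' : (0 : ℝ) < n.descFactorial k := by exact_mod_cast hpos
  rw [div_pow, div_le_div_iff₀ hpos' (by positivity)]
  calc ({S : Fin k ↪ Fin n | ∀ j, S j ∈ V}.ncard : ℝ) * (n : ℝ) ^ k
      ≤ (#V).descFactorial k * (n : ℝ) ^ k := by gcongr
    _ ≤ _ := by exact_mod_cast hmain

/-- The union bound for the existence of small sets of constraints on few variables. -/
theorem uniformProb_not_expanding_le {Ω : Type*} [Finite Ω] {k n m M : ℕ}
    (F : Set (Predicate Ω k)) (hn : 0 < n) (a : ℝ) (ha : ∀ c ≤ M, a * c ≤ n) :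
    uniformProb {I : CSPInstance F n m | ∃ U : Finset (Fin m), U.Nonempty ∧ #U ≤ M ∧
        (#(U.biUnion fun f => univ.map (I f).2) : ℝ) ≤ a * #U}
      ≤ ∑ c ∈ Icc 1 M, (m.choose c : ℝ) *
        (n.choose ⌊a * c⌋₊ * (((⌊a * c⌋₊ : ℝ) / n) ^ k) ^ c) := by
  classical
  cases nonempty_fintype Ω
  let E : Finset (Fin m) → Finset (Fin n) → Set (CSPInstance F n m) := fun U V =>
    {I | ∀ f ∈ U, I f ∈ {p : F × (Fin k ↪ Fin n) | ∀ j, p.2 j ∈ V}}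
  have hsub : {I : CSPInstance F n m | ∃ U : Finset (Fin m), U.Nonempty ∧ #U ≤ M ∧
      (#(U.biUnion fun f => univ.map (I f).2) : ℝ) ≤ a * #U}
      ⊆ ⋃ c ∈ Icc 1 M, ⋃ U ∈ powersetCard c (univ : Finset (Fin m)),
        ⋃ V ∈ powersetCard ⌊a * c⌋₊ (univ : Finset (Fin n)), E U V := by
    rintro I ⟨U, hne, hUM, hU⟩
    have h1 : #(U.biUnion fun f => univ.map (I f).2) ≤ ⌊a * (#U : ℝ)⌋₊ := Nat.le_floor hU
    have h2 : ⌊a * (#U : ℝ)⌋₊ ≤ n := by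
      rw [← Nat.floor_natCast (R := ℝ) n]
      exact Nat.floor_le_floor (ha _ hUM)
    -- Padding the neighbourhood to a fixed size allows a union bound over one value of `#V` per
    -- `c`.
    obtain ⟨V, hV1, hV2⟩ := exists_superset_card_eq h1 (by simpa using h2)
    simp only [Set.mem_iUnion, mem_Icc, mem_powersetCard_univ]
    refine ⟨#U, ⟨card_pos.2 hne, hUM⟩, U, rfl, V, hV2, fun f hf j => hV1 ?_⟩
    exact mem_biUnion.2 ⟨f, hf, by simp⟩
  refine (uniformProb_mono hsub).trans ((uniformProb_biUnion_le _ _).trans ?_)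
  refine sum_le_sum fun c _ => (uniformProb_biUnion_le _ _).trans ?_
  have hU : ∀ U ∈ powersetCard c (univ : Finset (Fin m)),
      uniformProb (⋃ V ∈ powersetCard ⌊a * (c : ℝ)⌋₊ (univ : Finset (Fin n)), E U V)
        ≤ n.choose ⌊a * (c : ℝ)⌋₊ * (((⌊a * (c : ℝ)⌋₊ : ℝ) / n) ^ k) ^ c := by
    intro U hU
    refine (uniformProb_biUnion_le _ _).trans ?_
    have hV : ∀ V ∈ powersetCard ⌊a * (c : ℝ)⌋₊ (univ : Finset (Fin n)),
        uniformProb (E U V) ≤ (((⌊a * (c : ℝ)⌋₊ : ℝ) / n) ^ k) ^ c := by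
      intro V hV
      have h1 := uniformProb_scope_le F hn V
      rw [mem_powersetCard_univ.1 hV] at h1
      have h2 := uniformProb_pi_le (by positivity) _ h1 U
      rwa [mem_powersetCard_univ.1 hU] at h2
    refine (sum_le_card_nsmul _ _ _ hV).trans (le_of_eq ?_)
    rw [card_powersetCard, card_univ, Fintype.card_fin, nsmul_eq_mul]
  refine (sum_le_card_nsmul _ _ _ hU).trans (le_of_eq ?_)
  rw [card_powersetCard, card_univ, Fintype.card_fin, nsmul_eq_mul]

end Probability

theorem degreeBound_nonneg {C β Δ : ℝ} {k τ n : ℕ} (hβ : 0 < β) (hΔ : 10 ≤ Δ) :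
    0 ≤ degreeBound C β Δ k τ n := by
  have := two_le_log hΔ
  unfold degreeBound
  positivity

/-- A random instance is expanding with probability at least `1 - β`. -/
theorem uniformProb_not_expanding_le_of_degreeBound {Ω : Type*} [Finite Ω] {k n m τ : ℕ}
    (F : Set (Predicate Ω k)) {Δ β ζ : ℝ} (hτ : 3 ≤ τ) (hτk : τ ≤ k) (hkn : k ≤ n) (hΔ : 10 ≤ Δ)
    (hm : (m : ℝ) = Δ * n) (hβ : 0 < β) (hβ1 : β < 1) (hζ : ζ = 1 / Real.log Δ) :
    uniformProb {I : CSPInstance F n m | ∃ U : Finset (Fin m), U.Nonempty ∧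
        #U ≤ ⌊8 * degreeBound 108 β Δ k τ n / ζ⌋₊ ∧
        (#(U.biUnion fun f => univ.map (I f).2) : ℝ) ≤ (k - (τ - ζ) / 2) * #U} ≤ β := by
  have hlog := two_le_log hΔ
  have hζ0 : 0 < ζ := by rw [hζ]; positivity
  have hζ1 : ζ ≤ 1 / 2 := by
    rw [hζ]
    exact one_div_le_one_div_of_le (by norm_num) hlog
  have hn : 0 < n := by omega
  have hn' : (0 : ℝ) < n := by exact_mod_cast hn
  have hk' : (0 : ℝ) < k := by exact_mod_cast (show 0 < k by omega)
  have hτ' : (3 : ℝ) ≤ τ := by exact_mod_cast hτ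
  have hτk' : (τ : ℝ) ≤ k := by exact_mod_cast hτk
  have hΔ0 : 0 < Δ := by linarith
  set M := ⌊8 * degreeBound 108 β Δ k τ n / ζ⌋₊ with hM
  -- The factor `log Δ` in the degree bound cancels against `1 / ζ`.
  have hy : ∀ c ≤ M, (k * c : ℝ) / n ≤ 8 * β ^ ((108 : ℝ) / τ)
      * (2 : ℝ) ^ (-(108 * k / τ : ℝ)) * Δ ^ (-(2 / ((τ : ℝ) - 2))) := by
    intro c hc
    have h1 : (c : ℝ) ≤ 8 * degreeBound 108 β Δ k τ n / ζ := by
      refine le_trans (by exact_mod_cast hc) (Nat.floor_le ?_)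
      exact div_nonneg (mul_nonneg (by norm_num) (degreeBound_nonneg hβ hΔ)) hζ0.le
    rw [div_le_iff₀ hn']
    calc (k * c : ℝ) ≤ k * (8 * degreeBound 108 β Δ k τ n / ζ) := by gcongr
      _ = _ := by
        unfold degreeBound
        rw [Real.rpow_neg (by norm_num), Real.rpow_neg hΔ0.le, hζ]
        have : (0 : ℝ) < (2 : ℝ) ^ (108 * k / τ : ℝ) := by positivity
        have : (0 : ℝ) < Δ ^ (2 / ((τ : ℝ) - 2)) := by positivity
        have : Real.log Δ ≠ 0 := by positivity
        field_simp
  have hy1 : ∀ c ≤ M, (k * c : ℝ) / n ≤ 1 := by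
    intro c hc
    refine (hy c hc).trans ?_
    have b1 : β ^ ((108 : ℝ) / τ) ≤ 1 := Real.rpow_le_one hβ.le hβ1.le (by positivity)
    have b2 : (2 : ℝ) ^ (-(108 * k / τ : ℝ)) ≤ 1 / 8 := by
      calc (2 : ℝ) ^ (-(108 * k / τ : ℝ)) ≤ (2 : ℝ) ^ (-3 : ℝ) := by
            apply Real.rpow_le_rpow_of_exponent_le (by norm_num)
            rw [neg_le_neg_iff, le_div_iff₀ (by linarith)]
            linarith
        _ = 1 / 8 := by
            rw [Real.rpow_neg (by norm_num)]
            norm_num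
    have b3 : Δ ^ (-(2 / ((τ : ℝ) - 2))) ≤ 1 := by
      apply Real.rpow_le_one_of_one_le_of_nonpos (by linarith)
      rw [neg_nonpos]
      exact div_nonneg (by norm_num) (by linarith)
    calc 8 * β ^ ((108 : ℝ) / τ) * (2 : ℝ) ^ (-(108 * k / τ : ℝ)) * Δ ^ (-(2 / ((τ : ℝ) - 2)))
        ≤ 8 * 1 * (1 / 8) * 1 := by gcongr
      _ = 1 := by norm_num
  have ha0 : (0 : ℝ) ≤ k - (τ - ζ) / 2 := by linarith
  refine (uniformProb_not_expanding_le F hn _ (fun c hc => ?_)).trans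
    (le_trans (sum_le_sum fun c hc => ?_) (sum_half_pow_le hβ hβ1 M))
  · have h1 := hy1 c hc
    rw [div_le_one hn'] at h1
    refine le_trans ?_ h1
    gcongr
    linarith
  · obtain ⟨hc1, hcM⟩ := mem_Icc.1 hc
    refine (union_bound_term_le (θ := (τ - ζ) / 2) (by omega) hn hc1 hm (by linarith) ?_
      (hy1 c hcM)).trans ?_
    · exact Nat.floor_le (by positivity)
    · gcongr
      exact base_le_half hτ hτk hΔ hβ hβ1 hζ (by positivity) (hy c hcM)

end RandomCSP

theorem theorem8p1 :
    ∃ C : ℝ, 0 < C ∧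
      ∀ (Ω : Type*) [Fintype Ω] [DecidableEq Ω] (L : Set (Equiv.Perm Ω)), L.Nonempty →
      ∀ (k : ℕ) (P : Predicate Ω k), 3 ≤ k → (∃ x, P x = false) → SupportsUniform P 2 →
      ∀ (n m : ℕ) (Δ β : ℝ), k ≤ n → 10 ≤ Δ → (m : ℝ) = Δ * n → 0 < β → β < 1 →
        uniformProb {I : CSPInstance (literalFamily P L) n m |
          ¬ SOSFailsToRefute ⌊degreeBound C β Δ k (complexity P) n⌋₊ I} ≤ β := by
  refine ⟨108, by norm_num, ?_⟩
  intro Ω _ _ L _ k P hk hP hP2 n m Δ β hkn hΔ hm hβ hβ1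
  obtain ⟨h3, hτk, -⟩ := complexity_mem hk hP
  have hsupp := supportsUniform_complexity_sub_one hk hP hP2
  set τ := complexity P with hτ
  have hlog := two_le_log hΔ
  set ζ : ℝ := 1 / Real.log Δ with hζ
  have hζ0 : 0 < ζ := by rw [hζ]; positivity
  have hζ1 : ζ ≤ 1 / 2 := by
    rw [hζ]
    exact one_div_le_one_div_of_le (by norm_num) hlog
  have hΩ : Nonempty Ω := ⟨hP.choose ⟨0, by omega⟩⟩
  refine le_trans (uniformProb_mono fun I hI => ?_)
    (uniformProb_not_expanding_le_of_degreeBound (literalFamily P L) h3 hτk hkn hΔ hm hβ hβ1 hζ)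
  by_contra hcon
  simp only [Set.mem_ofPred_eq, not_exists, not_and, not_le] at hcon
  refine hI (sosFailsToRefute_of_expanding
    (M := ⌊8 * degreeBound 108 β Δ k τ n / ζ⌋₊) (by omega) hτk
    (fun Q hQ => hsupp.of_mem_literalFamily hQ) hζ0 ?_ I fun U hU => ?_)
  · set D := degreeBound 108 β Δ k τ n with hD
    have hD0 : 0 ≤ D := degreeBound_nonneg hβ hΔ
    -- The factor 8 instead of 4 absorbs the rounding of `M` when `1 ≤ D`; below that the degree is
    -- zero.
    rcases lt_or_ge D 1 with hlt | hge
    · rw [Nat.floor_eq_zero.2 hlt]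
      simp only [Nat.cast_zero, mul_zero]
      positivity
    · have h1 : (⌊D⌋₊ : ℝ) ≤ D := Nat.floor_le hD0
      have h2 := (Nat.lt_floor_add_one (8 * D / ζ)).le
      rw [div_le_iff₀ hζ0] at h2
      nlinarith
  · rcases U.eq_empty_or_nonempty with rfl | hne
    · simp
    · have := hcon U hne hU
      linarith
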